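/- Let $B$ be a separable $C^*$-algebra, $n\ge 0$, and let $A^+$ denote a $C^*$-algebra $A$ with a unit adjoined (also when $A$ is already unital). Write $C_0(0,1)\otimes B=C_0((0,1),B)$, and let \[ \theta\colon K_1(B)\to K_0(C_0(0,1)\otimes B) \] be the suspension isomorphism. Explicitly, if $v\in GL_n(B^+)$ is congruent to $1$ modulo $M_n(B)$, and if $z\colon[0,1]\to GL_{2n}(B^+)$ is a continuous path of matrices congruent to $1$ modulo $M_{2n}(B)$ with $z_0=1$ and $z_1=\mathrm{diag}(v,v^{-1})$, then $\theta([v])=[zp_nz^{-1}]-[p_n]$, where $p_n=\mathrm{diag}(1_n,0)$. Let $u\in M_n(B)^+$ be a unitary that is congruent to $1$ modulo $M_n(B)$, and let $[u]\in K_1(B)$ be its class. Let \[ F(t)=1-t+tu\in M_n(B)^+,\qquad t\in[0,1]. \] Then: 1. $F$ is an element of $C([0,1],M_n(B))^+$, and it is invertible modulo the ideal $C_0((0,1),M_n(B))$. 2. $F$ therefore defines a relative class $[F]\in K_0(C_0(0,1)\otimes B)$, namely $[F]=[e]-[e_0]$ with \[ e=\begin{pmatrix} S_0^2 & S_0Q\\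 S_1(1+S_1)F & 1-S_1^2\end{pmatrix},\qquad e_0=\begin{pmatrix}0&0\\0&1\end{pmatrix},\qquad S_0=1-QF,\quad S_1=1-FQ, \] where $Q\in C([0,1],M_n(B))^+$ is an inverse of $F$ modulo $C_0((0,1),M_n(B))$; and for every choice of such a $Q$, \[ [F]=\theta([u]). \] -/

import Mathlib

namespace KTheory

open Matrix Topology unitInterval
open scoped ZeroAtInfty

section K0

/-- Murray-von Neumann (algebraic) equivalence of square matrices of possibly different sizes:
`e = x y` and `f = y x` for rectangular matrices `x`, `y`. -/
def MvN {R : Type*} [Ring R] {κ κ' : Type*} [Fintype κ] [Fintype κ']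
    (e : Matrix κ κ R) (f : Matrix κ' κ' R) : Prop :=
  ∃ (x : Matrix κ κ' R) (y : Matrix κ' κ R), x * y = e ∧ y * x = f

theorem MvN.symm {R : Type*} [Ring R] {κ κ' : Type*} [Fintype κ] [Fintype κ']
    {e : Matrix κ κ R} {f : Matrix κ' κ' R} (h : MvN e f) : MvN f e := by
  obtain ⟨x, y, h1, h2⟩ := h
  exact ⟨y, x, h2, h1⟩

theorem MvN.trans {R : Type*} [Ring R] {κ κ' κ'' : Type*} [Fintype κ] [Fintype κ'] [Fintype κ'']
    {e : Matrix κ κ R} {f : Matrix κ' κ' R} {g : Matrix κ'' κ'' R}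
    (he : e * e = e) (hg : g * g = g) (h : MvN e f) (h' : MvN f g) : MvN e g := by
  obtain ⟨x, y, h1, h2⟩ := h
  obtain ⟨x', y', h1', h2'⟩ := h'
  refine ⟨x * x', y' * y, ?_, ?_⟩
  · calc x * x' * (y' * y) = x * (x' * y') * y := by simp only [Matrix.mul_assoc]
      _ = (x * y) * (x * y) := by rw [h1', ← h2]; simp only [Matrix.mul_assoc]
      _ = e := by rw [h1, he]
  · calc y' * y * (x * x') = y' * (y * x) * x' := by simp only [Matrix.mul_assoc]
      _ = (y' * x') * (y' * x') := by rw [h2, ← h1']; simp only [Matrix.mul_assoc]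
      _ = g := by rw [h2', hg]

theorem MvN.of_reindex {R : Type*} [Ring R] {κ κ' : Type*} [Fintype κ] [Fintype κ']
    (s : κ ≃ κ') (e : Matrix κ κ R) (he : e * e = e) : MvN e (e.submatrix s.symm s.symm) := by
  classical
  refine ⟨e.submatrix id s.symm, e.submatrix s.symm id, ?_, ?_⟩
  · rw [Matrix.submatrix_mul_equiv, he, Matrix.submatrix_id_id]
  · have := Matrix.submatrix_mul_equiv e e s.symm (Equiv.refl κ) s.symm
    rw [he] at this
    exact this

theorem MvN.refl {R : Type*} [Ring R] {κ : Type*} [Fintype κ]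
    (e : Matrix κ κ R) (he : e * e = e) : MvN e e := ⟨e, e, he, he⟩

theorem MvN.block {R : Type*} [Ring R] {κ κ' μ μ' : Type*} [Fintype κ] [Fintype κ']
    [Fintype μ] [Fintype μ'] {e : Matrix κ κ R} {f : Matrix κ' κ' R} {e' : Matrix μ μ R}
    {f' : Matrix μ' μ' R} (h : MvN e f) (h' : MvN e' f') :
    MvN (fromBlocks e 0 0 e') (fromBlocks f 0 0 f') := by
  obtain ⟨x, y, h1, h2⟩ := h
  obtain ⟨x', y', h1', h2'⟩ := h'
  exact ⟨fromBlocks x 0 0 x', fromBlocks y 0 0 y', by simp [fromBlocks_multiply, h1, h1'],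
    by simp [fromBlocks_multiply, h2, h2']⟩

theorem block_idem {R : Type*} [Ring R] {κ κ' : Type*} [Fintype κ] [Fintype κ']
    {e : Matrix κ κ R} {f : Matrix κ' κ' R} (he : e * e = e) (hf : f * f = f) :
    fromBlocks e 0 0 f * fromBlocks e 0 0 f = fromBlocks e 0 0 f := by
  simp [fromBlocks_multiply, he, hf]

theorem reindex_idem {R : Type*} [Ring R] {κ κ' : Type*} [Fintype κ] [Fintype κ']
    (s : κ' ≃ κ) {e : Matrix κ κ R} (he : e * e = e) :
    e.submatrix s s * e.submatrix s s = e.submatrix s s := by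
  rw [Matrix.submatrix_mul_equiv, he]

/-- Idempotent matrices of all finite sizes over `R`, that is, the idempotents of
`M_∞(R)`. -/
structure IdemMat (R : Type*) [Ring R] where
  size : ℕ
  mat : Matrix (Fin size) (Fin size) R
  idem : mat * mat = mat

/-- Algebraic equivalence of idempotent matrices. -/
instance idemSetoid (R : Type*) [Ring R] : Setoid (IdemMat R) where
  r e f := MvN e.mat f.mat
  iseqv :=
    { refl := fun e => MvN.refl _ e.idem
      symm := fun h => h.symm
      trans := fun {e _ g} h h' => MvN.trans e.idem g.idem h h' }

/-- The monoid `V(R)` of equivalence classes of idempotent matrices over the unital ring `R`. -/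
def V (R : Type*) [Ring R] : Type _ := Quotient (idemSetoid R)

/-- The class in `V(R)` of an idempotent matrix with an arbitrary finite index set. -/
noncomputable def V.mk {R : Type*} [Ring R] {κ : Type*} [Fintype κ] (e : Matrix κ κ R)
    (he : e * e = e) : V R :=
  Quotient.mk (idemSetoid R) ⟨Fintype.card κ,
    e.submatrix (Fintype.equivFin κ).symm (Fintype.equivFin κ).symm, reindex_idem _ he⟩

theorem V.mk_eq {R : Type*} [Ring R] {κ κ' : Type*} [Fintype κ] [Fintype κ']
    {e : Matrix κ κ R} {f : Matrix κ' κ' R} (he : e * e = e) (hf : f * f = f) (h : MvN e f) :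
    V.mk e he = V.mk f hf := by
  refine Quotient.sound (s := idemSetoid R) ?_
  exact MvN.trans (reindex_idem _ he) (reindex_idem _ hf) (MvN.of_reindex _ e he).symm
    (MvN.trans he (reindex_idem _ hf) h (MvN.of_reindex _ f hf))

theorem V.mk_out {R : Type*} [Ring R] (e : IdemMat R) :
    (Quotient.mk (idemSetoid R) e : V R) = V.mk e.mat e.idem :=
  Quotient.sound (s := idemSetoid R) (MvN.of_reindex _ e.mat e.idem)

theorem V.ind {R : Type*} [Ring R] {P : V R → Prop}
    (h : ∀ (n : ℕ) (e : Matrix (Fin n) (Fin n) R) (he : e * e = e), P (V.mk e he)) (x : V R) :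
    P x := by
  refine Quotient.ind (fun e => ?_) x
  rw [V.mk_out]
  exact h _ _ _

/-- Addition in `V(R)` is the block sum of idempotents. -/
noncomputable instance V.instAdd (R : Type*) [Ring R] : Add (V R) where
  add := Quotient.map₂ (sa := idemSetoid R) (sb := idemSetoid R) (sc := idemSetoid R)
    (fun e f => ⟨e.size + f.size,
        (fromBlocks e.mat 0 0 f.mat).submatrix finSumFinEquiv.symm finSumFinEquiv.symm,
        reindex_idem _ (block_idem e.idem f.idem)⟩)
    (fun e e' h f f' h' =>
      MvN.trans (reindex_idem _ (block_idem e.idem f.idem))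
        (reindex_idem _ (block_idem e'.idem f'.idem))
        (MvN.of_reindex _ _ (block_idem e.idem f.idem)).symm
        (MvN.trans (block_idem e.idem f.idem) (reindex_idem _ (block_idem e'.idem f'.idem))
          (MvN.block h h') (MvN.of_reindex _ _ (block_idem e'.idem f'.idem))))

theorem V.mk_add {R : Type*} [Ring R] {κ κ' : Type*} [Fintype κ] [Fintype κ']
    {e : Matrix κ κ R} {f : Matrix κ' κ' R} (he : e * e = e) (hf : f * f = f) :
    V.mk e he + V.mk f hf = V.mk (fromBlocks e 0 0 f) (block_idem he hf) := by
  refine Quotient.sound (s := idemSetoid R) ?_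
  refine MvN.trans (reindex_idem _ (block_idem (reindex_idem _ he) (reindex_idem _ hf)))
    (reindex_idem _ (block_idem he hf))
    (MvN.of_reindex _ _ (block_idem (reindex_idem _ he) (reindex_idem _ hf))).symm ?_
  refine MvN.trans (block_idem (reindex_idem _ he) (reindex_idem _ hf))
    (reindex_idem _ (block_idem he hf)) (MvN.block (MvN.of_reindex _ _ he).symm
      (MvN.of_reindex _ _ hf).symm) (MvN.of_reindex _ _ (block_idem he hf))

noncomputable instance V.instZero (R : Type*) [Ring R] : Zero (V R) where
  zero := V.mk (0 : Matrix (Fin 0) (Fin 0) R) (Matrix.zero_mul _)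

noncomputable instance V.instAddCommMonoid (R : Type*) [Ring R] : AddCommMonoid (V R) where
  add_assoc := by
    refine V.ind fun n e he => V.ind fun m f hf => V.ind fun k g hg => ?_
    simp only [V.mk_add]
    refine V.mk_eq _ _ ?_
    convert MvN.of_reindex (Equiv.sumAssoc (Fin n) (Fin m) (Fin k)) _
      (block_idem (block_idem he hf) hg) using 1
    ext i j
    rcases i with i | i | i <;> rcases j with j | j | j <;> rfl
  zero_add := by
    refine V.ind fun n e he => ?_
    refine (V.mk_add (Matrix.zero_mul _) he).trans (V.mk_eq _ _ ?_)
    convert MvN.of_reindex (Equiv.emptySum (Fin 0) (Fin n)) _ (block_idem (Matrix.zero_mul (0 : Matrix (Fin 0) (Fin 0) R)) he) using 1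
    rfl
  add_zero := by
    refine V.ind fun n e he => ?_
    refine (V.mk_add he (Matrix.zero_mul _)).trans (V.mk_eq _ _ ?_)
    convert MvN.of_reindex (Equiv.sumEmpty (Fin n) (Fin 0)) _ (block_idem he (Matrix.zero_mul (0 : Matrix (Fin 0) (Fin 0) R))) using 1
    rfl
  add_comm := by
    refine V.ind fun n e he => V.ind fun m f hf => ?_
    simp only [V.mk_add]
    refine V.mk_eq _ _ ?_
    convert MvN.of_reindex (Equiv.sumComm (Fin n) (Fin m)) _ (block_idem he hf) using 1
    ext i j
    rcases i with i | i <;> rcases j with j | j <;> rfl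
  nsmul := nsmulRec

theorem map_idem {R S : Type*} [Ring R] [Ring S] (φ : R →+* S) {κ : Type*} [Fintype κ]
    {e : Matrix κ κ R} (he : e * e = e) : e.map φ * e.map φ = e.map φ := by
  rw [← Matrix.map_mul, he]

theorem MvN.map {R S : Type*} [Ring R] [Ring S] (φ : R →+* S) {κ κ' : Type*} [Fintype κ]
    [Fintype κ'] {e : Matrix κ κ R} {f : Matrix κ' κ' R} (h : MvN e f) :
    MvN (e.map φ) (f.map φ) := by
  obtain ⟨x, y, h1, h2⟩ := h
  exact ⟨x.map φ, y.map φ, by rw [← Matrix.map_mul, h1], by rw [← Matrix.map_mul, h2]⟩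

/-- The map `V(R) → V(S)` induced by a ring homomorphism. -/
noncomputable def V.mapFun {R S : Type*} [Ring R] [Ring S] (φ : R →+* S) : V R → V S :=
  Quotient.map (sa := idemSetoid R) (sb := idemSetoid S)
    (fun e => ⟨e.size, e.mat.map φ, map_idem φ e.idem⟩) (fun _ _ h => MvN.map φ h)

theorem V.mapFun_mk {R S : Type*} [Ring R] [Ring S] (φ : R →+* S) {κ : Type*} [Fintype κ]
    {e : Matrix κ κ R} (he : e * e = e) :
    V.mapFun φ (V.mk e he) = V.mk (e.map φ) (map_idem φ he) := rfl

/-- `V.mapFun` as a homomorphism of monoids. -/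
noncomputable def V.map {R S : Type*} [Ring R] [Ring S] (φ : R →+* S) : V R →+ V S where
  toFun := V.mapFun φ
  map_zero' := by
    exact (V.mapFun_mk φ _).trans (V.mk_eq _ (by simp) ⟨0, 0, by ext i; exact i.elim0,
      by ext i; exact i.elim0⟩)
  map_add' := by
    refine V.ind fun n e he => V.ind fun m f hf => ?_
    rw [V.mk_add, V.mapFun_mk, V.mapFun_mk, V.mapFun_mk, V.mk_add]
    refine V.mk_eq _ _ ?_
    convert MvN.refl _ (block_idem (map_idem φ he) (map_idem φ hf)) using 1
    rw [Matrix.fromBlocks_map]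
    simp

/-- The Grothendieck group of `V(R)`; for unital `R` this is the group `K₀(R)`. -/
abbrev K00 (R : Type*) [Ring R] : Type _ := Algebra.GrothendieckAddGroup (V R)

/-- The class in `K00 R` of an idempotent matrix. -/
noncomputable def K00.mk {R : Type*} [Ring R] {κ : Type*} [Fintype κ] (e : Matrix κ κ R)
    (he : e * e = e) : K00 R :=
  Algebra.GrothendieckAddGroup.of (V.mk e he)

/-- Functoriality of `K00`. -/
noncomputable def K00.map {R S : Type*} [Ring R] [Ring S] (φ : R →+* S) : K00 R →+ K00 S :=
  Algebra.GrothendieckAddGroup.lift (Algebra.GrothendieckAddGroup.of.comp (V.map φ))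

theorem K00.map_mk {R S : Type*} [Ring R] [Ring S] (φ : R →+* S) {κ : Type*} [Fintype κ]
    {e : Matrix κ κ R} (he : e * e = e) :
    K00.map φ (K00.mk e he) = K00.mk (e.map φ) (map_idem φ he) := by
  have : (K00.map φ).comp Algebra.GrothendieckAddGroup.of =
      Algebra.GrothendieckAddGroup.of.comp (V.map φ) :=
    Algebra.GrothendieckAddGroup.lift.symm_apply_apply _
  exact DFunLike.congr_fun this (V.mk e he)

theorem K00.mk_eq {R : Type*} [Ring R] {κ κ' : Type*} [Fintype κ] [Fintype κ']
    {e : Matrix κ κ R} {f : Matrix κ' κ' R} (he : e * e = e) (hf : f * f = f) (h : MvN e f) :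
    K00.mk e he = K00.mk f hf := by
  rw [K00.mk, K00.mk, V.mk_eq he hf h]

theorem K00.mk_add {R : Type*} [Ring R] {κ κ' : Type*} [Fintype κ] [Fintype κ']
    {e : Matrix κ κ R} {f : Matrix κ' κ' R} (he : e * e = e) (hf : f * f = f) :
    K00.mk e he + K00.mk f hf = K00.mk (fromBlocks e 0 0 f) (block_idem he hf) := by
  rw [K00.mk, K00.mk, ← map_add, V.mk_add, K00.mk]

/-- `K₀(A)` of a possibly non-unital complex algebra `A` (for a C*-algebra, its operator
`K₀`-group): the kernel of the map `K00(A⁺) → K00(ℂ)` induced by `A⁺ → ℂ`, where `A⁺` is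
`A` with a unit adjoined (also when `A` already has a unit). -/
noncomputable def K0 (A : Type*) [NonUnitalRing A] [Module ℂ A] [IsScalarTower ℂ A A] [SMulCommClass ℂ A A] :
    AddSubgroup (K00 (Unitization ℂ A)) :=
  (K00.map (Unitization.fstHom ℂ A).toRingHom).ker

/-- The formal difference `[e] - [f]` in `K₀(A)` of two idempotent matrices over `A⁺`
that agree modulo `A`. -/
noncomputable def K0.diff {A : Type*} [NonUnitalRing A] [Module ℂ A] [IsScalarTower ℂ A A]
    [SMulCommClass ℂ A A] {κ : Type*} [Fintype κ] (e f : Matrix κ κ (Unitization ℂ A))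
    (he : e * e = e) (hf : f * f = f) (h : ∀ i j, (e i j).fst = (f i j).fst) : K0 A :=
  ⟨K00.mk e he - K00.mk f hf, by
    rw [K0, AddMonoidHom.mem_ker, map_sub, K00.map_mk, K00.map_mk, sub_eq_zero]
    refine K00.mk_eq _ _ ?_
    have : e.map (Unitization.fstHom ℂ A).toRingHom = f.map (Unitization.fstHom ℂ A).toRingHom := by
      ext i j
      exact h i j
    rw [this]
    exact MvN.refl _ (map_idem _ hf)⟩

end K0

section K1

variable {B : Type*} [NonUnitalCStarAlgebra B]

/-- The scalar part `M_ι(B⁺) → M_ι(ℂ)`. -/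
noncomputable def scalarPart (ι : Type*) [Fintype ι] [DecidableEq ι] (B : Type*)
    [NonUnitalCStarAlgebra B] : Matrix ι ι (Unitization ℂ B) →+* Matrix ι ι ℂ :=
  (Unitization.fstHom ℂ B).toRingHom.mapMatrix

/-- `GL_ι⁺(B)`: the invertible matrices over `B⁺` that are congruent to `1` modulo `M_ι(B)`,
with the topology of the group of units of `M_ι(B⁺)`. -/
noncomputable def GLplus (ι : Type*) [Fintype ι] [DecidableEq ι] (B : Type*)
    [NonUnitalCStarAlgebra B] : Subgroup (Matrix ι ι (Unitization ℂ B))ˣ :=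
  (Units.map (scalarPart ι B).toMonoidHom).ker

variable {ι κ μ : Type*} [Fintype ι] [DecidableEq ι] [Fintype κ] [DecidableEq κ]
  [Fintype μ] [DecidableEq μ]

theorem mem_GLplus {u : (Matrix ι ι (Unitization ℂ B))ˣ} :
    u ∈ GLplus ι B ↔ scalarPart ι B u.val = 1 := by
  rw [GLplus, MonoidHom.mem_ker, Units.ext_iff]
  rfl

/-- The matrix underlying an element of `GL_ι⁺(B)`. -/
noncomputable def glMat (u : GLplus ι B) : Matrix ι ι (Unitization ℂ B) :=
  (u : (Matrix ι ι (Unitization ℂ B))ˣ).val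

theorem GLplus.ext {u v : GLplus ι B} (h : glMat u = glMat v) : u = v :=
  Subtype.ext (Units.ext h)

theorem GLplus.mat_one : glMat (1 : GLplus ι B) = 1 := rfl

theorem GLplus.mat_mul (u v : GLplus ι B) : glMat (u * v) = glMat u * glMat v := rfl

theorem GLplus.mat_mul_inv (u : GLplus ι B) : glMat u * glMat u⁻¹ = 1 := by
  rw [← GLplus.mat_mul, mul_inv_cancel, GLplus.mat_one]

theorem GLplus.mat_inv_mul (u : GLplus ι B) : glMat u⁻¹ * glMat u = 1 := by
  rw [← GLplus.mat_mul, inv_mul_cancel, GLplus.mat_one]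

theorem GLplus.scalarPart_mat (u : GLplus ι B) : scalarPart ι B (glMat u) = 1 :=
  mem_GLplus.1 u.2

theorem GLplus.continuous_mat : Continuous (glMat : GLplus ι B → _) :=
  Units.continuous_val.comp continuous_subtype_val

/-- An element of `GL_ι⁺(B)` from two mutually inverse matrices. -/
noncomputable def GLplus.mk (x y : Matrix ι ι (Unitization ℂ B)) (hxy : x * y = 1)
    (hyx : y * x = 1) (h : scalarPart ι B x = 1) : GLplus ι B :=
  ⟨⟨x, y, hxy, hyx⟩, mem_GLplus.2 h⟩

/-- A multiplicative map between matrix rings over `B⁺` that preserves congruence to `1`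
modulo `B` restricts to `GL⁺`. -/
noncomputable def GLplus.map
    (φ : Matrix ι ι (Unitization ℂ B) →* Matrix κ κ (Unitization ℂ B))
    (h : ∀ M, scalarPart ι B M = 1 → scalarPart κ B (φ M) = 1) : GLplus ι B →* GLplus κ B :=
  ((Units.map φ).comp (GLplus ι B).subtype).codRestrict (GLplus κ B)
    fun u => mem_GLplus.2 (h _ (mem_GLplus.1 u.2))

theorem GLplus.mat_map
    (φ : Matrix ι ι (Unitization ℂ B) →* Matrix κ κ (Unitization ℂ B))
    (h : ∀ M, scalarPart ι B M = 1 → scalarPart κ B (φ M) = 1) (u : GLplus ι B) :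
    glMat (GLplus.map φ h u) = φ (glMat u) := rfl

theorem GLplus.continuous_map
    (φ : Matrix ι ι (Unitization ℂ B) →* Matrix κ κ (Unitization ℂ B))
    (h : ∀ M, scalarPart ι B M = 1 → scalarPart κ B (φ M) = 1) (hφ : Continuous φ) :
    Continuous (GLplus.map φ h) :=
  Continuous.subtype_mk ((Continuous.units_map φ hφ).comp continuous_subtype_val) _

/-- `u ↦ diag(u, 1)` on matrices. -/
def blockLeft (R : Type*) [Ring R] (ι κ : Type*) [Fintype ι] [DecidableEq ι] [Fintype κ]
    [DecidableEq κ] : Matrix ι ι R →* Matrix (ι ⊕ κ) (ι ⊕ κ) R where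
  toFun M := fromBlocks M 0 0 1
  map_one' := fromBlocks_one
  map_mul' M N := by simp [fromBlocks_multiply]

/-- `u ↦ diag(1, u)` on matrices. -/
def blockRight (R : Type*) [Ring R] (ι κ : Type*) [Fintype ι] [DecidableEq ι] [Fintype κ]
    [DecidableEq κ] : Matrix κ κ R →* Matrix (ι ⊕ κ) (ι ⊕ κ) R where
  toFun M := fromBlocks 1 0 0 M
  map_one' := fromBlocks_one
  map_mul' M N := by simp [fromBlocks_multiply]

/-- Renaming of the index set of square matrices. -/
def renameHom (R : Type*) [Ring R] (s : ι ≃ κ) : Matrix ι ι R →* Matrix κ κ R where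
  toFun M := M.submatrix s.symm s.symm
  map_one' := by simp
  map_mul' M N := by rw [Matrix.submatrix_mul_equiv]

theorem scalarPart_fromBlocks (a : Matrix ι ι (Unitization ℂ B)) (b : Matrix ι κ (Unitization ℂ B))
    (c : Matrix κ ι (Unitization ℂ B)) (d : Matrix κ κ (Unitization ℂ B)) :
    scalarPart (ι ⊕ κ) B (fromBlocks a b c d) = fromBlocks (scalarPart ι B a)
      (b.map (Unitization.fstHom ℂ B)) (c.map (Unitization.fstHom ℂ B)) (scalarPart κ B d) :=
  Matrix.fromBlocks_map _ _ _ _ _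

/-- `u ↦ diag(u, 1)` on `GL⁺`. -/
noncomputable def GLplus.left (κ : Type*) [Fintype κ] [DecidableEq κ] :
    GLplus ι B →* GLplus (ι ⊕ κ) B :=
  GLplus.map (blockLeft _ ι κ) fun M hM => by
    refine (scalarPart_fromBlocks _ _ _ _).trans ?_
    rw [hM, map_one]
    ext i j
    rcases i with i | i <;> rcases j with j | j <;> simp [Matrix.one_apply]

/-- `u ↦ diag(1, u)` on `GL⁺`. -/
noncomputable def GLplus.right (ι : Type*) [Fintype ι] [DecidableEq ι] :
    GLplus κ B →* GLplus (ι ⊕ κ) B :=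
  GLplus.map (blockRight _ ι κ) fun M hM => by
    refine (scalarPart_fromBlocks _ _ _ _).trans ?_
    rw [hM, map_one]
    ext i j
    rcases i with i | i <;> rcases j with j | j <;> simp [Matrix.one_apply]

/-- Renaming of the index set on `GL⁺`. -/
noncomputable def GLplus.rename (s : ι ≃ κ) : GLplus ι B →* GLplus κ B :=
  GLplus.map (renameHom _ s) fun M hM => by
    have : scalarPart κ B (renameHom _ s M) = renameHom _ s (scalarPart ι B M) := rfl
    rw [this, hM, map_one]

theorem GLplus.continuous_left : Continuous (GLplus.left κ : GLplus ι B → _) :=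
  GLplus.continuous_map _ _ (by
    change Continuous fun M : Matrix ι ι (Unitization ℂ B) => fromBlocks M 0 0 1
    fun_prop)

theorem GLplus.continuous_right : Continuous (GLplus.right ι : GLplus κ B → _) :=
  GLplus.continuous_map _ _ (by
    change Continuous fun M : Matrix κ κ (Unitization ℂ B) => fromBlocks 1 0 0 M
    fun_prop)

theorem GLplus.continuous_rename (s : ι ≃ κ) :
    Continuous (GLplus.rename s : GLplus ι B → GLplus κ B) :=
  GLplus.continuous_map _ _ (by
    change Continuous fun M : Matrix ι ι (Unitization ℂ B) => M.submatrix s.symm s.symm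
    fun_prop)

/-- The block sum `diag(u, v)` in `GL⁺`. -/
noncomputable def GLplus.block (u : GLplus ι B) (v : GLplus κ B) : GLplus (ι ⊕ κ) B :=
  GLplus.left κ u * GLplus.right ι v

theorem GLplus.mat_block (u : GLplus ι B) (v : GLplus κ B) :
    glMat (GLplus.block u v) = fromBlocks (glMat u) 0 0 (glMat v) := by
  change fromBlocks (glMat u) 0 0 1 * fromBlocks 1 0 0 (glMat v) = _
  simp [fromBlocks_multiply]

theorem GLplus.mat_rename (s : ι ≃ κ) (u : GLplus ι B) :
    glMat (GLplus.rename s u) = (glMat u).submatrix s.symm s.symm := rfl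

theorem GLplus.block_mul (u u' : GLplus ι B) (v v' : GLplus κ B) :
    GLplus.block (u * u') (v * v') = GLplus.block u v * GLplus.block u' v' := by
  refine GLplus.ext ?_
  simp [GLplus.mat_mul, GLplus.mat_block, fromBlocks_multiply]

theorem GLplus.block_one : GLplus.block (1 : GLplus ι B) (1 : GLplus κ B) = 1 := by
  refine GLplus.ext ?_
  simp [GLplus.mat_block, GLplus.mat_one]

theorem GLplus.block_inv (u : GLplus ι B) (v : GLplus κ B) :
    (GLplus.block u v)⁻¹ = GLplus.block u⁻¹ v⁻¹ := by
  rw [inv_eq_iff_mul_eq_one, ← GLplus.block_mul, mul_inv_cancel, mul_inv_cancel,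
    GLplus.block_one]

/-- The path component `GL_ι⁺(B)₀` of `1` in `GL_ι⁺(B)`. -/
noncomputable def GLzero (ι : Type*) [Fintype ι] [DecidableEq ι] (B : Type*)
    [NonUnitalCStarAlgebra B] : Subgroup (GLplus ι B) where
  carrier := {u | Joined 1 u}
  one_mem' := Joined.refl 1
  mul_mem' := fun {u v} ⟨a⟩ ⟨b⟩ => by
    have := a.mul b
    rw [one_mul] at this
    exact ⟨this⟩
  inv_mem' := fun {u} ⟨a⟩ => by
    have := a.inv
    rw [inv_one] at this
    exact ⟨this⟩

instance GLzero.normal : (GLzero ι B).Normal where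
  conj_mem u hu g := by
    obtain ⟨a⟩ := hu
    have := (a.map (f := fun x => g * x * g⁻¹) (by fun_prop))
    refine ⟨this.cast (by simp) rfl⟩

/-- The index bijection used to enlarge `n × n` matrices to `m × m` matrices. -/
def padEquiv {n m : ℕ} (h : n ≤ m) : Fin n ⊕ Fin (m - n) ≃ Fin m :=
  finSumFinEquiv.trans (finCongr (by omega))

/-- The stabilisation `u ↦ diag(u, 1)` from `GL_n⁺(B)` to `GL_m⁺(B)`. -/
noncomputable def stab {n m : ℕ} (h : n ≤ m) : GLplus (Fin n) B →* GLplus (Fin m) B :=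
  (GLplus.rename (padEquiv h)).comp (GLplus.left (Fin (m - n)))

theorem continuous_stab {n m : ℕ} (h : n ≤ m) :
    Continuous (stab h : GLplus (Fin n) B → GLplus (Fin m) B) :=
  (GLplus.continuous_rename _).comp GLplus.continuous_left

theorem mat_stab {n m : ℕ} (h : n ≤ m) (u : GLplus (Fin n) B) (i j : Fin m) :
    glMat (stab h u) i j =
      if hij : i.val < n ∧ j.val < n then glMat u ⟨i, hij.1⟩ ⟨j, hij.2⟩
      else if i = j then 1 else 0 := by
  obtain ⟨i, rfl⟩ := (padEquiv h).surjective i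
  obtain ⟨j, rfl⟩ := (padEquiv h).surjective j
  have : (glMat (stab h u)) (padEquiv h i) (padEquiv h j) = fromBlocks (glMat u) 0 0 1 i j := by
    change (fromBlocks (glMat u) 0 0 1) ((padEquiv h).symm (padEquiv h i))
      ((padEquiv h).symm (padEquiv h j)) = _
    simp
  rw [this]
  rcases i with i | i <;> rcases j with j | j <;>
    simp [padEquiv, Matrix.one_apply, Fin.ext_iff, i.isLt, j.isLt] <;> omega

theorem stab_self {n : ℕ} (u : GLplus (Fin n) B) : stab le_rfl u = u := by
  refine GLplus.ext (Matrix.ext fun i j => ?_)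
  rw [mat_stab]
  simp

theorem stab_stab {n m k : ℕ} (h : n ≤ m) (h' : m ≤ k) (u : GLplus (Fin n) B) :
    stab h' (stab h u) = stab (h.trans h') u := by
  refine GLplus.ext (Matrix.ext fun i j => ?_)
  simp only [mat_stab, Fin.ext_iff]
  split_ifs <;> first | rfl | (exfalso; omega)

/-- `π₀(GL_n⁺(B)) = GL_n⁺(B) / GL_n⁺(B)₀`. -/
abbrev PiZero (n : ℕ) (B : Type*) [NonUnitalCStarAlgebra B] : Type _ :=
  GLplus (Fin n) B ⧸ GLzero (Fin n) B

/-- The map `π₀(GL_n⁺(B)) → π₀(GL_m⁺(B))` induced by `u ↦ diag(u, 1)`. -/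
noncomputable def piStab (B : Type*) [NonUnitalCStarAlgebra B] (n m : ℕ) (h : n ≤ m) :
    PiZero n B →* PiZero m B :=
  QuotientGroup.map _ _ (stab h) (by
    rintro u ⟨a⟩
    exact ⟨(a.map (continuous_stab h)).cast (map_one _).symm rfl⟩)

instance piStab.directedSystem (B : Type*) [NonUnitalCStarAlgebra B] :
    DirectedSystem (PiZero · B) (piStab B · · ·) where
  map_self _ := by
    intro x
    induction x using QuotientGroup.induction_on with
    | H u => exact congrArg _ (stab_self u)
  map_map _ _ _ _ _ := by
    intro x
    induction x using QuotientGroup.induction_on with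
    | H u => exact congrArg _ (stab_stab _ _ u)

/-- `K₁(B) = lim GL_n⁺(B) / GL_n⁺(B)₀`, written additively. -/
abbrev K1 (B : Type*) [NonUnitalCStarAlgebra B] : Type _ :=
  Additive (DirectLimit (PiZero · B) (piStab B))

/-- The class in `K₁(B)` of an element of `GL_n⁺(B)`. -/
noncomputable def K1.mk {n : ℕ} (u : GLplus (Fin n) B) : K1 B :=
  Additive.ofMul ⟦⟨n, QuotientGroup.mk u⟩⟧

end K1

section Loops

variable {B : Type*} [NonUnitalCStarAlgebra B]

/-- The suspension `C₀((0,1), B) = C₀(0,1) ⊗ B`. -/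
abbrev Susp (B : Type*) [NonUnitalCStarAlgebra B] : Type _ := C₀(Set.Ioo (0 : ℝ) 1, B)

/-- A continuous `f : [0,1] → B` with `f 0 = 0 = f 1`, as an element of `C₀((0,1), B)`. -/
def toSusp (f : C(I, B)) (h0 : f 0 = 0) (h1 : f 1 = 0) : Susp B where
  toFun t := f ⟨t.1, Set.Ioo_subset_Icc_self t.2⟩
  continuous_toFun := by fun_prop
  zero_at_infty' := by
    rw [Metric.tendsto_nhds]
    intro ε hε
    have hK : IsCompact {t : I | ε ≤ dist (f t) 0} :=
      (isClosed_le continuous_const (by fun_prop)).isCompact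
    have hK' := hK.image (continuous_subtype_val (p := fun x : ℝ => x ∈ I))
    have hsub : Subtype.val '' {t : I | ε ≤ dist (f t) 0} ⊆ Set.Ioo (0 : ℝ) 1 := by
      rintro _ ⟨t, ht, rfl⟩
      refine ⟨lt_of_le_of_ne t.2.1 fun h => ?_, lt_of_le_of_ne t.2.2 fun h => ?_⟩
      · have : t = 0 := Subtype.ext h.symm
        rw [this, Set.mem_ofPred_eq, h0, dist_self] at ht
        exact absurd hε (not_lt.2 ht)
      · have : t = 1 := Subtype.ext h
        rw [this, Set.mem_ofPred_eq, h1, dist_self] at ht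
        exact absurd hε (not_lt.2 ht)
    have hK'' : IsCompact ((Subtype.val : Set.Ioo (0 : ℝ) 1 → ℝ) ⁻¹'
        (Subtype.val '' {t : I | ε ≤ dist (f t) 0})) :=
      Topology.IsInducing.subtypeVal.isCompact_preimage' hK' (by rwa [Subtype.range_coe])
    filter_upwards [hK''.compl_mem_cocompact] with t ht
    by_contra hcon
    exact ht ⟨⟨t.1, Set.Ioo_subset_Icc_self t.2⟩, not_lt.1 hcon, rfl⟩

/-- Evaluation `C₀((0,1), B)⁺ → B⁺` at a point of `(0,1)`. -/
noncomputable def evSusp (t : Set.Ioo (0 : ℝ) 1) :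
    Unitization ℂ (Susp B) →+* Unitization ℂ B where
  toFun x := Unitization.inl x.fst + Unitization.inr (x.snd t)
  map_one' := by ext <;> simp
  map_mul' x y := by ext <;> simp
  map_zero' := by ext <;> simp
  map_add' x y := by ext <;> simp

theorem evSusp_ext {x y : Unitization ℂ (Susp B)} (h : ∀ t, evSusp t x = evSusp t y) : x = y := by
  have key : ∀ t : Set.Ioo (0 : ℝ) 1, x.fst = y.fst ∧ x.snd t = y.snd t := fun t =>
    ⟨by simpa [evSusp] using congrArg (fun z => z.fst) (h t),
      by simpa [evSusp] using congrArg (fun z => z.snd) (h t)⟩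
  refine Unitization.ext (key ⟨1 / 2, by norm_num, by norm_num⟩).1 ?_
  exact DFunLike.ext _ _ fun t => (key t).2

theorem evSusp_matrix_ext {m n : Type*} {M N : Matrix m n (Unitization ℂ (Susp B))}
    (h : ∀ t, M.map (evSusp t) = N.map (evSusp t)) : M = N := by
  ext1 i j
  exact evSusp_ext fun t => congrFun (congrFun (h t) i) j

variable {κ μ : Type*} [Fintype κ] [DecidableEq κ] [Fintype μ] [DecidableEq μ]

/-- A scalar matrix regarded as a matrix over `A⁺`. -/
noncomputable def scalarMat (A : Type*) [NonUnitalRing A] [Module ℂ A] [IsScalarTower ℂ A A]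
    [SMulCommClass ℂ A A] {κ : Type*} (p : Matrix κ κ ℂ) : Matrix κ κ (Unitization ℂ A) :=
  p.map (Unitization.inlRingHom ℂ A)

/-- A continuous family `M : [0,1] → M_κ(B⁺)` with `M t ≡ p` modulo `M_κ(B)` for all `t` and
`M 0 = p = M 1`, where `p` is a scalar matrix. Such families are the matrices over
`C₀((0,1), B)⁺` with scalar part `p`. -/
structure IsLoop (p : Matrix κ κ ℂ) (M : C(I, Matrix κ κ (Unitization ℂ B))) : Prop where
  scalar : ∀ t, scalarPart κ B (M t) = p
  zero : M 0 = scalarMat B p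
  one : M 1 = scalarMat B p

/-- The matrix over `C₀((0,1), B)⁺` given by a loop. -/
noncomputable def IsLoop.lift {p : Matrix κ κ ℂ} {M : C(I, Matrix κ κ (Unitization ℂ B))}
    (h : IsLoop p M) : Matrix κ κ (Unitization ℂ (Susp B)) := fun i j =>
  Unitization.inl (p i j) + Unitization.inr (toSusp
    ⟨fun t => (M t i j).snd, (Unitization.continuous_snd (𝕜 := ℂ) (A := B)).comp
      (M.continuous.matrix_elem i j)⟩
    (by simp [h.zero, scalarMat]) (by simp [h.one, scalarMat]))

theorem IsLoop.map_ev_lift {p : Matrix κ κ ℂ} {M : C(I, Matrix κ κ (Unitization ℂ B))}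
    (h : IsLoop p M) (t : Set.Ioo (0 : ℝ) 1) :
    h.lift.map (evSusp t) = M ⟨t.1, Set.Ioo_subset_Icc_self t.2⟩ := by
  ext1 i j
  have : (M ⟨t.1, Set.Ioo_subset_Icc_self t.2⟩ i j).fst = p i j :=
    congrFun (congrFun (h.scalar ⟨t.1, Set.Ioo_subset_Icc_self t.2⟩) i) j
  refine Unitization.ext ?_ ?_
  · simpa [evSusp, IsLoop.lift] using this.symm
  · simp [evSusp, IsLoop.lift, toSusp]

theorem map_ev_scalarMat {κ : Type*} (p : Matrix κ κ ℂ) (t : Set.Ioo (0 : ℝ) 1) :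
    (scalarMat (Susp B) p).map (evSusp t) = scalarMat B p := by
  ext1 i j
  refine Unitization.ext ?_ ?_ <;> simp [scalarMat, evSusp]

theorem IsLoop.lift_mul {p q r : Matrix κ κ ℂ} {M N L : C(I, Matrix κ κ (Unitization ℂ B))}
    (hM : IsLoop p M) (hN : IsLoop q N) (hL : IsLoop r L) (h : ∀ t, M t * N t = L t) :
    hM.lift * hN.lift = hL.lift := by
  refine evSusp_matrix_ext fun t => ?_
  rw [Matrix.map_mul, hM.map_ev_lift, hN.map_ev_lift, hL.map_ev_lift, h]

theorem IsLoop.idem_scalar {p : Matrix κ κ ℂ} {M : C(I, Matrix κ κ (Unitization ℂ B))}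
    (h : IsLoop p M) (hM : ∀ t, M t * M t = M t) : p * p = p := by
  rw [← h.scalar 0, ← map_mul, hM]

theorem scalarMat_idem {κ : Type*} [Fintype κ] {A : Type*} [NonUnitalRing A] [Module ℂ A] [IsScalarTower ℂ A A]
    [SMulCommClass ℂ A A] {p : Matrix κ κ ℂ} (hp : p * p = p) :
    scalarMat A p * scalarMat A p = scalarMat A p :=
  map_idem _ hp

/-- The class `[e] - [p] ∈ K₀(C₀((0,1), B))` of a loop `e` of idempotents that is congruent to the
scalar idempotent `p` modulo `B` and has `e 0 = p = e 1`. -/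
noncomputable def loopClass {p : Matrix κ κ ℂ} {e : C(I, Matrix κ κ (Unitization ℂ B))}
    (h : IsLoop p e) (he : ∀ t, e t * e t = e t) : K0 (Susp B) :=
  K0.diff h.lift (scalarMat (Susp B) p) (h.lift_mul h h he)
    (scalarMat_idem (h.idem_scalar he)) (fun i j => by simp [IsLoop.lift, scalarMat])

theorem coe_loopClass {p : Matrix κ κ ℂ} {e : C(I, Matrix κ κ (Unitization ℂ B))}
    (h : IsLoop p e) (he : ∀ t, e t * e t = e t) :
    (loopClass h he : K00 (Unitization ℂ (Susp B))) = K00.mk h.lift (h.lift_mul h h he) -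
      K00.mk (scalarMat (Susp B) p) (scalarMat_idem (h.idem_scalar he)) := rfl

theorem loopClass_congr {p : Matrix κ κ ℂ} {e e' : C(I, Matrix κ κ (Unitization ℂ B))}
    (h : IsLoop p e) (he : ∀ t, e t * e t = e t) (h' : IsLoop p e')
    (he' : ∀ t, e' t * e' t = e' t) (w w' : C(I, Matrix κ κ (Unitization ℂ B)))
    (hw : IsLoop 1 w) (hw' : IsLoop 1 w') (hww' : ∀ t, w' t * w t = 1)
    (hconj : ∀ t, e' t = w t * e t * w' t) : loopClass h he = loopClass h' he' := by
  refine Subtype.ext ?_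
  rw [coe_loopClass, coe_loopClass]
  congr 1
  refine K00.mk_eq _ _ ⟨h.lift * hw'.lift, hw.lift * h.lift, ?_, ?_⟩ <;>
    refine evSusp_matrix_ext fun t => ?_ <;>
    simp only [Matrix.map_mul, IsLoop.map_ev_lift, hconj]
  · set s : I := ⟨t.1, Set.Ioo_subset_Icc_self t.2⟩
    calc e s * w' s * (w s * e s) = e s * (w' s * w s) * e s := by
          simp only [Matrix.mul_assoc]
      _ = e s := by rw [hww', Matrix.mul_one, he]
  · set s : I := ⟨t.1, Set.Ioo_subset_Icc_self t.2⟩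
    calc w s * e s * (e s * w' s) = w s * (e s * e s) * w' s := by
          simp only [Matrix.mul_assoc]
      _ = w s * e s * w' s := by rw [he]

theorem loopClass_rename {p : Matrix κ κ ℂ} {e : C(I, Matrix κ κ (Unitization ℂ B))}
    (h : IsLoop p e) (he : ∀ t, e t * e t = e t) (s : κ ≃ μ) {q : Matrix μ μ ℂ}
    {f : C(I, Matrix μ μ (Unitization ℂ B))} (h' : IsLoop q f) (hf : ∀ t, f t * f t = f t)
    (hq : q = p.submatrix s.symm s.symm) (hfe : ∀ t, f t = (e t).submatrix s.symm s.symm) :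
    loopClass h' hf = loopClass h he := by
  refine Subtype.ext ?_
  rw [coe_loopClass, coe_loopClass]
  congr 1
  · refine K00.mk_eq _ _ (MvN.symm ?_)
    convert MvN.of_reindex s _ (h.lift_mul h h he) using 1
    refine evSusp_matrix_ext fun t => ?_
    rw [h'.map_ev_lift, hfe, ← h.map_ev_lift]
    rfl
  · refine K00.mk_eq _ _ (MvN.symm ?_)
    convert MvN.of_reindex s _ (scalarMat_idem (A := Susp B) (h.idem_scalar he)) using 1
    rw [hq]
    rfl

theorem loopClass_block {p : Matrix κ κ ℂ} {e : C(I, Matrix κ κ (Unitization ℂ B))}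
    (h : IsLoop p e) (he : ∀ t, e t * e t = e t) {q : Matrix μ μ ℂ}
    {f : C(I, Matrix μ μ (Unitization ℂ B))} (h' : IsLoop q f) (hf : ∀ t, f t * f t = f t)
    {r : Matrix (κ ⊕ μ) (κ ⊕ μ) ℂ} {g : C(I, Matrix (κ ⊕ μ) (κ ⊕ μ) (Unitization ℂ B))}
    (h'' : IsLoop r g) (hg : ∀ t, g t * g t = g t) (hr : r = fromBlocks p 0 0 q)
    (hgef : ∀ t, g t = fromBlocks (e t) 0 0 (f t)) :
    loopClass h'' hg = loopClass h he + loopClass h' hf := by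
  refine Subtype.ext ?_
  rw [AddSubgroup.coe_add, coe_loopClass, coe_loopClass, coe_loopClass, sub_add_sub_comm,
    K00.mk_add, K00.mk_add]
  congr 1
  · refine K00.mk_eq _ _ ?_
    convert MvN.refl _ (h''.lift_mul h'' h'' hg) using 1
    refine evSusp_matrix_ext fun t => ?_
    rw [h''.map_ev_lift, hgef, ← h.map_ev_lift, ← h'.map_ev_lift, Matrix.fromBlocks_map]
    simp
  · refine K00.mk_eq _ _ ?_
    convert MvN.refl _ (scalarMat_idem (A := Susp B) (h''.idem_scalar hg)) using 1
    subst hr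
    ext i j <;> rcases i with i | i <;> rcases j with j | j <;> simp [scalarMat]

end Loops

section Suspension

variable {B : Type*} [NonUnitalCStarAlgebra B]
variable {ι κ μ : Type*} [Fintype ι] [DecidableEq ι] [Fintype κ] [DecidableEq κ]
  [Fintype μ] [DecidableEq μ]

theorem scalarPart_scalarMat (p : Matrix κ κ ℂ) : scalarPart κ B (scalarMat B p) = p := by
  ext i j
  change (Unitization.inl (p i j) : Unitization ℂ B).fst = p i j
  simp

theorem scalarMat_one : scalarMat B (1 : Matrix κ κ ℂ) = 1 :=
  (Unitization.inlRingHom ℂ B).mapMatrix.map_one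

/-- A continuous path `z : [0,1] → GL_κ⁺(B)` whose end points commute with the scalar
idempotent `p`. -/
structure Rotates (p : Matrix κ κ ℂ) (z : C(I, GLplus κ B)) : Prop where
  idem : p * p = p
  zero : glMat (z 0) * scalarMat B p = scalarMat B p * glMat (z 0)
  one : glMat (z 1) * scalarMat B p = scalarMat B p * glMat (z 1)

/-- The family of idempotents `t ↦ z t * p * (z t)⁻¹`. -/
noncomputable def rotLoop (p : Matrix κ κ ℂ) (z : C(I, GLplus κ B)) :
    C(I, Matrix κ κ (Unitization ℂ B)) where
  toFun t := glMat (z t) * scalarMat B p * glMat (z t)⁻¹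
  continuous_toFun := by
    have h1 : Continuous fun t => glMat (z t) := GLplus.continuous_mat.comp z.continuous
    have h2 : Continuous fun t => glMat (z t)⁻¹ :=
      GLplus.continuous_mat.comp (continuous_inv.comp z.continuous)
    exact (h1.mul continuous_const).mul h2

theorem rotLoop_apply (p : Matrix κ κ ℂ) (z : C(I, GLplus κ B)) (t : I) :
    rotLoop p z t = glMat (z t) * scalarMat B p * glMat (z t)⁻¹ := rfl

theorem Rotates.isLoop {p : Matrix κ κ ℂ} {z : C(I, GLplus κ B)} (h : Rotates p z) :
    IsLoop p (rotLoop p z) where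
  scalar t := by
    rw [rotLoop_apply, map_mul, map_mul, GLplus.scalarPart_mat, GLplus.scalarPart_mat,
      scalarPart_scalarMat, one_mul, mul_one]
  zero := by rw [rotLoop_apply, h.zero, Matrix.mul_assoc, GLplus.mat_mul_inv, Matrix.mul_one]
  one := by rw [rotLoop_apply, h.one, Matrix.mul_assoc, GLplus.mat_mul_inv, Matrix.mul_one]

theorem Rotates.loop_idem {p : Matrix κ κ ℂ} {z : C(I, GLplus κ B)} (h : Rotates p z) (t : I) :
    rotLoop p z t * rotLoop p z t = rotLoop p z t := by
  rw [rotLoop_apply]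
  set P := scalarMat B p
  have hP : P * P = P := scalarMat_idem h.idem
  calc glMat (z t) * P * glMat (z t)⁻¹ * (glMat (z t) * P * glMat (z t)⁻¹)
      = glMat (z t) * P * (glMat (z t)⁻¹ * glMat (z t)) * P * glMat (z t)⁻¹ := by
        simp only [Matrix.mul_assoc]
    _ = glMat (z t) * (P * P) * glMat (z t)⁻¹ := by
        rw [GLplus.mat_inv_mul, Matrix.mul_one]
        simp only [Matrix.mul_assoc]
    _ = _ := by rw [hP]

/-- The class `[z p z⁻¹] - [p] ∈ K₀(C₀((0,1), B))`. -/
noncomputable def rotClass {p : Matrix κ κ ℂ} {z : C(I, GLplus κ B)} (h : Rotates p z) :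
    K0 (Susp B) :=
  loopClass h.isLoop h.loop_idem

theorem loopOfGL {w : C(I, GLplus κ B)} (h0 : w 0 = 1) (h1 : w 1 = 1) :
    IsLoop 1 (⟨fun t => glMat (w t), GLplus.continuous_mat.comp w.continuous⟩ :
      C(I, Matrix κ κ (Unitization ℂ B))) where
  scalar t := GLplus.scalarPart_mat _
  zero := by rw [scalarMat_one, ContinuousMap.coe_mk, h0, GLplus.mat_one]
  one := by rw [scalarMat_one, ContinuousMap.coe_mk, h1, GLplus.mat_one]

/-- The class `[z p z⁻¹] - [p]` only depends on the end points of `z`, up to paths in the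
commutant of `p`. -/
theorem rotClass_eq {p : Matrix κ κ ℂ} {z z' : C(I, GLplus κ B)} (h : Rotates p z)
    (h' : Rotates p z') (d : C(I, GLplus κ B))
    (hd : ∀ t, glMat (d t) * scalarMat B p = scalarMat B p * glMat (d t))
    (h0 : z' 0 = z 0 * d 0) (h1 : z' 1 = z 1 * d 1) : rotClass h = rotClass h' := by
  refine loopClass_congr _ _ _ _ _ _ (loopOfGL (w := z' * (z * d)⁻¹) ?_ ?_)
    (loopOfGL (w := (z * d) * z'⁻¹) ?_ ?_) (fun t => ?_) (fun t => ?_)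
  · simp [h0]
  · simp [h1]
  · simp [h0]
  · simp [h1]
  · change glMat (z t * d t * (z' t)⁻¹) * glMat (z' t * (z t * d t)⁻¹) = 1
    rw [← GLplus.mat_mul]
    simp [GLplus.mat_one]
  · change glMat (z' t) * scalarMat B p * glMat (z' t)⁻¹ = glMat (z' t * (z t * d t)⁻¹) *
      (glMat (z t) * scalarMat B p * glMat (z t)⁻¹) * glMat (z t * d t * (z' t)⁻¹)
    have e1 : glMat (z' t * (z t * d t)⁻¹) = glMat (z' t) * glMat (d t)⁻¹ * glMat (z t)⁻¹ := by
      rw [← GLplus.mat_mul, ← GLplus.mat_mul, _root_.mul_inv_rev, mul_assoc]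
    have e2 : glMat (z t * d t * (z' t)⁻¹) = glMat (z t) * glMat (d t) * glMat (z' t)⁻¹ := by
      rw [← GLplus.mat_mul, ← GLplus.mat_mul]
    rw [e1, e2]
    set P := scalarMat B p
    calc glMat (z' t) * P * glMat (z' t)⁻¹
        = glMat (z' t) * ((glMat (d t)⁻¹ * glMat (d t)) * P) * glMat (z' t)⁻¹ := by
          rw [GLplus.mat_inv_mul, Matrix.one_mul]
      _ = glMat (z' t) * (glMat (d t)⁻¹ * (P * glMat (d t))) * glMat (z' t)⁻¹ := by
          rw [Matrix.mul_assoc _ (glMat (d t)) P, hd]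
      _ = glMat (z' t) * glMat (d t)⁻¹ * (1 * P * 1) * glMat (d t) * glMat (z' t)⁻¹ := by
          rw [Matrix.one_mul, Matrix.mul_one]
          simp only [Matrix.mul_assoc]
      _ = _ := by
          rw [← GLplus.mat_inv_mul (z t)]
          simp only [Matrix.mul_assoc]

theorem rotClass_one {p : Matrix κ κ ℂ} (h : Rotates p (1 : C(I, GLplus κ B))) :
    rotClass h = 0 := by
  refine Subtype.ext ?_
  rw [rotClass, coe_loopClass, AddSubgroup.coe_zero, sub_eq_zero]
  refine K00.mk_eq _ _ ?_
  convert MvN.refl _ (scalarMat_idem (A := Susp B) h.idem) using 1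
  refine evSusp_matrix_ext fun t => ?_
  rw [IsLoop.map_ev_lift, map_ev_scalarMat, rotLoop_apply]
  change glMat (1 : GLplus κ B) * _ * glMat (1 : GLplus κ B)⁻¹ = _
  rw [inv_one, GLplus.mat_one, Matrix.one_mul, Matrix.mul_one]

/-- Pointwise block sum of paths. -/
noncomputable def blockPath (z : C(I, GLplus κ B)) (w : C(I, GLplus μ B)) :
    C(I, GLplus (κ ⊕ μ) B) where
  toFun t := GLplus.block (z t) (w t)
  continuous_toFun := (GLplus.continuous_left.comp z.continuous).mul
    (GLplus.continuous_right.comp w.continuous)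

/-- Pointwise renaming of paths. -/
noncomputable def renamePath (s : κ ≃ μ) (z : C(I, GLplus κ B)) : C(I, GLplus μ B) where
  toFun t := GLplus.rename s (z t)
  continuous_toFun := (GLplus.continuous_rename s).comp z.continuous

/-- Pointwise conjugation of a path. -/
noncomputable def conjPath (g : GLplus κ B) (z : C(I, GLplus κ B)) : C(I, GLplus κ B) where
  toFun t := g * z t * g⁻¹
  continuous_toFun := (continuous_const.mul z.continuous).mul continuous_const

theorem blockPath_apply (z : C(I, GLplus κ B)) (w : C(I, GLplus μ B)) (t : I) :
    blockPath z w t = GLplus.block (z t) (w t) := rfl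

theorem renamePath_apply (s : κ ≃ μ) (z : C(I, GLplus κ B)) (t : I) :
    renamePath s z t = GLplus.rename s (z t) := rfl

theorem conjPath_apply (g : GLplus κ B) (z : C(I, GLplus κ B)) (t : I) :
    conjPath g z t = g * z t * g⁻¹ := rfl

theorem scalarMat_block {κ μ : Type*} (p : Matrix κ κ ℂ) (q : Matrix μ μ ℂ) :
    scalarMat B (fromBlocks p 0 0 q) = fromBlocks (scalarMat B p) 0 0 (scalarMat B q) := by
  ext i j <;> rcases i with i | i <;> rcases j with j | j <;> simp [scalarMat]

theorem Rotates.block {p : Matrix κ κ ℂ} {z : C(I, GLplus κ B)} (h : Rotates p z)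
    {q : Matrix μ μ ℂ} {w : C(I, GLplus μ B)} (h' : Rotates q w) :
    Rotates (fromBlocks p 0 0 q) (blockPath z w) where
  idem := block_idem h.idem h'.idem
  zero := by
    change glMat (GLplus.block (z 0) (w 0)) * _ = _ * glMat (GLplus.block (z 0) (w 0))
    simp [GLplus.mat_block, scalarMat_block, fromBlocks_multiply, h.zero, h'.zero]
  one := by
    change glMat (GLplus.block (z 1) (w 1)) * _ = _ * glMat (GLplus.block (z 1) (w 1))
    simp [GLplus.mat_block, scalarMat_block, fromBlocks_multiply, h.one, h'.one]

theorem rotClass_block {p : Matrix κ κ ℂ} {z : C(I, GLplus κ B)} (h : Rotates p z)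
    {q : Matrix μ μ ℂ} {w : C(I, GLplus μ B)} (h' : Rotates q w) :
    rotClass (h.block h') = rotClass h + rotClass h' := by
  refine loopClass_block _ _ _ _ _ _ rfl fun t => ?_
  change glMat (GLplus.block (z t) (w t)) * _ * glMat (GLplus.block (z t) (w t))⁻¹ = _
  rw [GLplus.block_inv, GLplus.mat_block, GLplus.mat_block, scalarMat_block]
  simp [fromBlocks_multiply, rotLoop_apply]

theorem rename_commutes {p : Matrix κ κ ℂ} {g : GLplus κ B}
    (h : glMat g * scalarMat B p = scalarMat B p * glMat g) (s : κ ≃ μ) :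
    glMat (GLplus.rename s g) * scalarMat B (p.submatrix s.symm s.symm) =
      scalarMat B (p.submatrix s.symm s.symm) * glMat (GLplus.rename s g) := by
  have e : scalarMat B (p.submatrix s.symm s.symm) =
      (scalarMat B p).submatrix s.symm s.symm := rfl
  rw [e, GLplus.mat_rename, Matrix.submatrix_mul_equiv, Matrix.submatrix_mul_equiv, h]

theorem Rotates.rename {p : Matrix κ κ ℂ} {z : C(I, GLplus κ B)} (h : Rotates p z) (s : κ ≃ μ) :
    Rotates (p.submatrix s.symm s.symm) (renamePath s z) where
  idem := reindex_idem _ h.idem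
  zero := rename_commutes h.zero s
  one := rename_commutes h.one s

theorem rotClass_rename {p : Matrix κ κ ℂ} {z : C(I, GLplus κ B)} (h : Rotates p z)
    (s : κ ≃ μ) : rotClass (h.rename s) = rotClass h := by
  refine loopClass_rename _ _ s _ _ rfl fun t => ?_
  change glMat (GLplus.rename s (z t)) * (scalarMat B p).submatrix s.symm s.symm *
    glMat (GLplus.rename s (z t))⁻¹ = _
  rw [← map_inv, GLplus.mat_rename, GLplus.mat_rename, Matrix.submatrix_mul_equiv,
    Matrix.submatrix_mul_equiv]
  rfl

theorem rotClass_rename' {p : Matrix κ κ ℂ} {z : C(I, GLplus κ B)} (h : Rotates p z)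
    (s : κ ≃ μ) {q : Matrix μ μ ℂ} (hq : q = p.submatrix s.symm s.symm)
    (h' : Rotates q (renamePath s z)) : rotClass h' = rotClass h := by
  subst hq
  exact rotClass_rename h s

theorem rename_sumComm (a b c d : GLplus ι B) :
    GLplus.rename (Equiv.sumSumSumComm ι ι ι ι) (GLplus.block (GLplus.block a b)
      (GLplus.block c d)) = GLplus.block (GLplus.block a c) (GLplus.block b d) := by
  refine GLplus.ext ?_
  simp only [GLplus.mat_rename, GLplus.mat_block]
  ext1 i j
  rcases i with (i | i) | (i | i) <;> rcases j with (j | j) | (j | j) <;> rfl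

/-- The scalar projection `p_ι = diag(1, 0)`. -/
def stdProj (ι : Type*) [Fintype ι] [DecidableEq ι] : Matrix (ι ⊕ ι) (ι ⊕ ι) ℂ :=
  fromBlocks 1 0 0 0

theorem stdProj_idem : stdProj ι * stdProj ι = stdProj ι := by
  simp [stdProj, fromBlocks_multiply]

theorem scalarMat_stdProj : scalarMat B (stdProj ι) = fromBlocks 1 0 0 0 := by
  rw [stdProj, scalarMat_block, scalarMat_one]
  congr 1

theorem block_commutes (u v : GLplus ι B) : glMat (GLplus.block u v) * scalarMat B (stdProj ι) =
    scalarMat B (stdProj ι) * glMat (GLplus.block u v) := by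
  simp [scalarMat_stdProj, GLplus.mat_block, fromBlocks_multiply]

/-- A rotation for `u ∈ GL_ι⁺(B)`: a continuous path in `GL_{2ι}⁺(B)` from `1`
to `diag(u, u⁻¹)`. -/
structure IsRotation (u : GLplus ι B) (z : C(I, GLplus (ι ⊕ ι) B)) : Prop where
  zero : z 0 = 1
  one : z 1 = GLplus.block u u⁻¹

theorem IsRotation.rotates {u : GLplus ι B} {z : C(I, GLplus (ι ⊕ ι) B)} (h : IsRotation u z) :
    Rotates (stdProj ι) z where
  idem := stdProj_idem
  zero := by rw [h.zero, ← GLplus.block_one, block_commutes]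
  one := by rw [h.one, block_commutes]

theorem IsRotation.rotClass_eq {u : GLplus ι B} {z z' : C(I, GLplus (ι ⊕ ι) B)}
    (h : IsRotation u z) (h' : IsRotation u z') : rotClass h.rotates = rotClass h'.rotates := by
  refine KTheory.rotClass_eq _ _ 1 (fun t => ?_) ?_ ?_
  · change glMat (1 : GLplus (ι ⊕ ι) B) * _ = _ * glMat (1 : GLplus (ι ⊕ ι) B)
    rw [GLplus.mat_one, Matrix.one_mul, Matrix.mul_one]
  · rw [h.zero, h'.zero]; simp
  · rw [h.one, h'.one]; simp

/-- Elementary matrix `(1 a; 0 1)`. -/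
def upper {R : Type*} [Ring R] (a : Matrix ι ι R) : (Matrix (ι ⊕ ι) (ι ⊕ ι) R)ˣ :=
  ⟨fromBlocks 1 a 0 1, fromBlocks 1 (-a) 0 1, by simp [fromBlocks_multiply],
    by simp [fromBlocks_multiply]⟩

/-- Elementary matrix `(1 0; a 1)`. -/
def lower {R : Type*} [Ring R] (a : Matrix ι ι R) : (Matrix (ι ⊕ ι) (ι ⊕ ι) R)ˣ :=
  ⟨fromBlocks 1 0 a 1, fromBlocks 1 0 (-a) 1, by simp [fromBlocks_multiply],
    by simp [fromBlocks_multiply]⟩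

theorem upper_neg {R : Type*} [Ring R] (a : Matrix ι ι R) : upper (-a) = (upper a)⁻¹ :=
  Units.ext rfl

theorem lower_neg {R : Type*} [Ring R] (a : Matrix ι ι R) : lower (-a) = (lower a)⁻¹ :=
  Units.ext rfl

theorem continuous_upper {R : Type*} [Ring R] [TopologicalSpace R] [IsTopologicalRing R] :
    Continuous (upper : Matrix ι ι R → _) := by
  rw [Units.continuous_iff]
  constructor
  · change Continuous fun a : Matrix ι ι R => fromBlocks 1 a 0 1
    fun_prop
  · change Continuous fun a : Matrix ι ι R => fromBlocks 1 (-a) 0 1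
    fun_prop

theorem continuous_lower {R : Type*} [Ring R] [TopologicalSpace R] [IsTopologicalRing R] :
    Continuous (lower : Matrix ι ι R → _) := by
  rw [Units.continuous_iff]
  constructor
  · change Continuous fun a : Matrix ι ι R => fromBlocks 1 0 a 1
    fun_prop
  · change Continuous fun a : Matrix ι ι R => fromBlocks 1 0 (-a) 1
    fun_prop

/-- The product of elementary matrices
`U(a) L(-a') U(a) U(-b) L(b) U(-b)`. -/
def whitehead {R : Type*} [Ring R] (a a' b : Matrix ι ι R) : (Matrix (ι ⊕ ι) (ι ⊕ ι) R)ˣ :=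
  upper a * lower (-a') * upper a * upper (-b) * lower b * upper (-b)

theorem whitehead_self {R : Type*} [Ring R] (a : Matrix ι ι R) : whitehead a a a = 1 := by
  simp [whitehead, upper_neg, lower_neg, mul_assoc]

theorem map_upper {R S : Type*} [Ring R] [Ring S] (φ : R →+* S) (a : Matrix ι ι R) :
    Units.map φ.mapMatrix.toMonoidHom (upper a) = upper (a.map φ) := by
  refine Units.ext ?_
  change (fromBlocks 1 a 0 1).map φ = fromBlocks 1 (a.map φ) 0 1
  rw [Matrix.fromBlocks_map]
  simp

theorem map_lower {R S : Type*} [Ring R] [Ring S] (φ : R →+* S) (a : Matrix ι ι R) :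
    Units.map φ.mapMatrix.toMonoidHom (lower a) = lower (a.map φ) := by
  refine Units.ext ?_
  change (fromBlocks 1 0 a 1).map φ = fromBlocks 1 0 (a.map φ) 1
  rw [Matrix.fromBlocks_map]
  simp

theorem map_whitehead {R S : Type*} [Ring R] [Ring S] (φ : R →+* S) (a a' b : Matrix ι ι R) :
    Units.map φ.mapMatrix.toMonoidHom (whitehead a a' b) =
      whitehead (a.map φ) (a'.map φ) (b.map φ) := by
  have hneg : ∀ c : Matrix ι ι R, (-c).map φ = -(c.map φ) := fun c => by ext; simp
  simp only [whitehead, map_mul, map_upper, map_lower, hneg]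

theorem whitehead_val {R : Type*} [Ring R] (a a' : Matrix ι ι R) (h : a * a' = 1)
    (h' : a' * a = 1) : (whitehead a a' 1).val = fromBlocks a 0 0 a' := by
  simp [whitehead, upper, lower, fromBlocks_multiply, h, h']

theorem continuous_whitehead {X R : Type*} [Ring R] [TopologicalSpace R] [IsTopologicalRing R]
    [TopologicalSpace X] {a a' b : X → Matrix ι ι R} (ha : Continuous a) (ha' : Continuous a')
    (hb : Continuous b) : Continuous fun x => whitehead (a x) (a' x) (b x) := by
  have h1 := continuous_upper.comp ha
  have h2 := continuous_lower.comp ha'.neg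
  have h3 := continuous_upper.comp hb.neg
  have h4 := continuous_lower.comp hb
  exact ((((h1.mul h2).mul h1).mul h3).mul h4).mul h3

/-- A rotation for `u`: a path in `GL_{2ι}⁺(B)` from `1` to `diag(u, u⁻¹)`. -/
noncomputable def rotation (u : GLplus ι B) : C(I, GLplus (ι ⊕ ι) B) where
  toFun t := ⟨whitehead ((t : ℂ) • glMat u) ((t : ℂ) • glMat u⁻¹) ((t : ℂ) • 1), by
    rw [GLplus, MonoidHom.mem_ker]
    have key : ∀ v : GLplus ι B, ((t : ℂ) • glMat v).map (Unitization.fstHom ℂ B).toRingHom =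
        (t : ℂ) • 1 := fun v => by
      rw [← GLplus.scalarPart_mat v]
      ext i j
      simp [scalarPart]
    refine (map_whitehead _ _ _ _).trans ?_
    have h1 := key 1
    rw [GLplus.mat_one] at h1
    rw [key, key, h1, whitehead_self]⟩
  continuous_toFun := by
    refine Continuous.subtype_mk (continuous_whitehead ?_ ?_ ?_) _ <;> fun_prop

theorem isRotation_rotation (u : GLplus ι B) : IsRotation u (rotation u) where
  zero := by
    refine Subtype.ext ?_
    change whitehead (((0 : I) : ℂ) • glMat u) _ _ = 1
    simp only [Set.Icc.coe_zero, Complex.ofReal_zero, zero_smul, whitehead_self]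
  one := by
    refine GLplus.ext ?_
    change (whitehead (((1 : I) : ℂ) • glMat u) (((1 : I) : ℂ) • glMat u⁻¹)
      (((1 : I) : ℂ) • 1)).val = _
    simp only [Set.Icc.coe_one, Complex.ofReal_one, one_smul]
    rw [whitehead_val _ _ (GLplus.mat_mul_inv u) (GLplus.mat_inv_mul u), GLplus.mat_block]

/-- `θ` on `GL_ι⁺(B)`: for a path `z` from `1` to `diag(u, u⁻¹)`,
`θ(u) = [z p z⁻¹] - [p]` with `p = diag(1, 0)`. -/
noncomputable def thetaGL (u : GLplus ι B) : K0 (Susp B) :=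
  rotClass (isRotation_rotation u).rotates

theorem thetaGL_eq {u : GLplus ι B} {z : C(I, GLplus (ι ⊕ ι) B)} (h : IsRotation u z) :
    thetaGL u = rotClass h.rotates :=
  (isRotation_rotation u).rotClass_eq h

theorem thetaGL_eq_zero {u : GLplus ι B} (h : Joined 1 u) : thetaGL u = 0 := by
  obtain ⟨g⟩ := h
  have h1 : Rotates (stdProj ι) (1 : C(I, GLplus (ι ⊕ ι) B)) :=
    IsRotation.rotates (u := 1) ⟨rfl, by rw [inv_one, GLplus.block_one]; rfl⟩
  rw [← rotClass_one h1]
  refine (rotClass_eq h1 _ (blockPath g.toContinuousMap g.toContinuousMap⁻¹)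
    (fun t => block_commutes _ _) ?_ ?_).symm
  · rw [(isRotation_rotation u).zero]
    change 1 = 1 * GLplus.block (g 0) (g 0)⁻¹
    simp [GLplus.block_one]
  · rw [(isRotation_rotation u).one]
    change _ = 1 * GLplus.block (g 1) (g 1)⁻¹
    simp

theorem thetaGL_mul (u v : GLplus ι B) : thetaGL (u * v) = thetaGL u + thetaGL v := by
  have huv := (isRotation_rotation (u * v)).rotates
  have hu := (isRotation_rotation u).rotates
  have hv := (isRotation_rotation v).rotates
  have h1 : Rotates (stdProj ι) (1 : C(I, GLplus (ι ⊕ ι) B)) :=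
    IsRotation.rotates (u := 1) ⟨rfl, by rw [inv_one, GLplus.block_one]; rfl⟩
  have key : rotClass (hu.block hv) = rotClass (huv.block h1) := by
    refine rotClass_eq _ _ (renamePath (Equiv.sumSumSumComm ι ι ι ι)
        (blockPath (rotation v) (conjPath (GLplus.block u 1) (rotation v⁻¹)))) (fun t => ?_) ?_ ?_
    · have hp : fromBlocks (stdProj ι) 0 0 (stdProj ι) =
          (fromBlocks (1 : Matrix (ι ⊕ ι) (ι ⊕ ι) ℂ) 0 0
            (0 : Matrix (ι ⊕ ι) (ι ⊕ ι) ℂ)).submatrix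
            (Equiv.sumSumSumComm ι ι ι ι).symm (Equiv.sumSumSumComm ι ι ι ι).symm := by
        ext i j
        rcases i with (i | i) | (i | i) <;> rcases j with (j | j) | (j | j) <;>
          simp [stdProj, Matrix.one_apply]
      rw [hp]
      exact rename_commutes (block_commutes _ _) _
    · rw [blockPath_apply, blockPath_apply, renamePath_apply, blockPath_apply, conjPath_apply,
        ContinuousMap.one_apply, (isRotation_rotation (u * v)).zero, (isRotation_rotation u).zero,
        (isRotation_rotation v).zero, (isRotation_rotation v⁻¹).zero, mul_one, mul_inv_cancel,
        GLplus.block_one, map_one, mul_one]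
    · rw [blockPath_apply, blockPath_apply, renamePath_apply, blockPath_apply, conjPath_apply,
        (isRotation_rotation (u * v)).one, (isRotation_rotation u).one,
        (isRotation_rotation v).one, (isRotation_rotation v⁻¹).one, GLplus.block_inv,
        ← GLplus.block_mul, ← GLplus.block_mul, rename_sumComm, ← GLplus.block_mul,
        ← GLplus.block_mul, ← GLplus.block_mul, ContinuousMap.one_apply, ← GLplus.block_one]
      congr 2 <;> group
  rw [rotClass_block hu hv, rotClass_block huv h1, rotClass_one h1, add_zero] at key
  exact key.symm

/-- Stabilisation does not change `θ`. -/
theorem thetaGL_stab {n m : ℕ} (h : n ≤ m) (u : GLplus (Fin n) B) :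
    thetaGL (stab h u) = thetaGL u := by
  have hu := (isRotation_rotation u).rotates
  have h1 : Rotates (stdProj (Fin (m - n)))
      (1 : C(I, GLplus (Fin (m - n) ⊕ Fin (m - n)) B)) :=
    IsRotation.rotates (u := 1) ⟨rfl, by rw [inv_one, GLplus.block_one]; rfl⟩
  let s := (Equiv.sumSumSumComm (Fin n) (Fin n) (Fin (m - n)) (Fin (m - n))).trans
    (Equiv.sumCongr (padEquiv h) (padEquiv h))
  have hrot : IsRotation (stab h u) (renamePath s (blockPath (rotation u) 1)) := by
    constructor
    · change GLplus.rename s (GLplus.block (rotation u 0) 1) = 1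
      rw [(isRotation_rotation u).zero, GLplus.block_one, map_one]
    · change GLplus.rename s (GLplus.block (rotation u 1) 1) = _
      rw [(isRotation_rotation u).one, ← map_inv]
      refine GLplus.ext ?_
      rw [GLplus.mat_rename, GLplus.mat_block, GLplus.mat_block, GLplus.mat_block]
      change _ = fromBlocks ((fromBlocks (glMat u) 0 0 1).submatrix (padEquiv h).symm
        (padEquiv h).symm) 0 0 ((fromBlocks (glMat u⁻¹) 0 0 1).submatrix (padEquiv h).symm
        (padEquiv h).symm)
      rw [GLplus.mat_one, ← fromBlocks_one]
      ext1 i j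
      obtain ⟨i, rfl⟩ := s.surjective i
      obtain ⟨j, rfl⟩ := s.surjective j
      rw [Matrix.submatrix_apply, s.symm_apply_apply, s.symm_apply_apply]
      rcases i with (i | i) | (i | i) <;> rcases j with (j | j) | (j | j) <;>
        simp [s, Matrix.one_apply]
  rw [thetaGL_eq hrot, rotClass_rename' (hu.block h1) s ?_ hrot.rotates, rotClass_block hu h1,
    rotClass_one h1, add_zero]
  · rfl
  · ext i j
    obtain ⟨i, rfl⟩ := s.surjective i
    obtain ⟨j, rfl⟩ := s.surjective j
    rw [Matrix.submatrix_apply, s.symm_apply_apply, s.symm_apply_apply]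
    rcases i with (i | i) | (i | i) <;> rcases j with (j | j) | (j | j) <;>
      simp [s, stdProj, Matrix.one_apply]

end Suspension

section Theta

variable {B : Type*} [NonUnitalCStarAlgebra B]

/-- `thetaGL` on `GL_n⁺(B) / GL_n⁺(B)₀`. -/
noncomputable def thetaPi (n : ℕ) (B : Type*) [NonUnitalCStarAlgebra B] :
    PiZero n B →* Multiplicative (K0 (Susp B)) :=
  QuotientGroup.lift _
    { toFun := fun u => Multiplicative.ofAdd (thetaGL u)
      map_one' := congrArg Multiplicative.ofAdd (thetaGL_eq_zero (Joined.refl 1))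
      map_mul' := fun u v => congrArg Multiplicative.ofAdd (thetaGL_mul u v) }
    (fun _ hu => congrArg Multiplicative.ofAdd (thetaGL_eq_zero hu))

/-- The suspension isomorphism `θ : K₁(B) → K₀(C₀((0,1), B))`, as a homomorphism: the class of
`u ∈ GL_n⁺(B)` goes to `[z p z⁻¹] - [p]`, where `p = diag(1, 0)` and `z` is a path in
`GL_{2n}⁺(B)` from `1` to `diag(u, u⁻¹)`. -/
noncomputable def theta (B : Type*) [NonUnitalCStarAlgebra B] : K1 B →+ K0 (Susp B) where
  toFun x := Multiplicative.toAdd (DirectLimit.lift (piStab B) (fun n x => thetaPi n B x)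
    (fun _ _ h x => by
      induction x using QuotientGroup.induction_on with
      | H u => exact congrArg Multiplicative.ofAdd (thetaGL_stab h u).symm) x.toMul)
  map_zero' := congrArg Multiplicative.toAdd (DirectLimit.lift_one (f := piStab B) (thetaPi · B) _)
  map_add' x y := congrArg Multiplicative.toAdd
    (DirectLimit.lift_mul (f := piStab B) (thetaPi · B) _ x.toMul y.toMul)

/-- The value of `θ` on `[u]` is `[z p z⁻¹] - [p]`, for every path `z` in `GL_{2n}⁺(B)` from `1`
to `diag(u, u⁻¹)`. -/
theorem theta_mk {n : ℕ} {u : GLplus (Fin n) B} {z : C(I, GLplus (Fin n ⊕ Fin n) B)}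
    (h : IsRotation u z) : theta B (K1.mk u) = rotClass h.rotates :=
  thetaGL_eq h

end Theta

section Relative

variable {B : Type*} [NonUnitalCStarAlgebra B]

/-- The inclusion `M_ι(B)⁺ → M_ι(B⁺)`, `(c, b) ↦ c • 1 + b`. -/
noncomputable def plusToMat (ι : Type*) [Fintype ι] [DecidableEq ι] (B : Type*)
    [NonUnitalCStarAlgebra B] :
    Unitization ℂ (Matrix ι ι B) →+* Matrix ι ι (Unitization ℂ B) where
  toFun x := scalarMat B (x.fst • 1) + x.snd.map Unitization.inr
  map_one' := by
    ext i j <;> simp [scalarMat, Matrix.one_apply]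
  map_mul' x y := by
    have hs : ∀ c d : ℂ, scalarMat B (c • 1 : Matrix ι ι ℂ) * scalarMat B (d • 1) =
        scalarMat B ((c * d) • 1) := fun c d => by
      rw [scalarMat, scalarMat, ← Matrix.map_mul, scalarMat, smul_mul_smul_comm, Matrix.mul_one]
    have hd : ∀ c : ℂ, scalarMat B (c • 1 : Matrix ι ι ℂ) =
        Matrix.diagonal fun _ => Unitization.inl c := fun c => by
      ext i j <;> by_cases h : i = j <;> simp [scalarMat, h]
    have hl : ∀ (c : ℂ) (b : Matrix ι ι B), scalarMat B (c • 1 : Matrix ι ι ℂ) *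
        b.map Unitization.inr = (c • b).map Unitization.inr := fun c b => by
      rw [hd]
      ext i j <;> simp
    have hr : ∀ (c : ℂ) (b : Matrix ι ι B), b.map Unitization.inr *
        scalarMat B (c • 1 : Matrix ι ι ℂ) = (c • b).map Unitization.inr := fun c b => by
      rw [hd]
      ext i j <;> simp
    have hm : ∀ b c : Matrix ι ι B, (b.map Unitization.inr * c.map Unitization.inr :
        Matrix ι ι (Unitization ℂ B)) = (b * c).map Unitization.inr := fun b c => by
      exact (Matrix.map_mul (f := Unitization.inrNonUnitalAlgHom ℂ B)).symm
    rw [add_mul, mul_add, mul_add, hs, hl, hr, hm]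
    ext i j <;> simp [scalarMat]
    abel
  map_zero' := by ext <;> simp [scalarMat]
  map_add' x y := by
    ext i j <;> simp [scalarMat, add_mul]

theorem scalarPart_plusToMat {ι : Type*} [Fintype ι] [DecidableEq ι]
    (x : Unitization ℂ (Matrix ι ι B)) : scalarPart ι B (plusToMat ι B x) = x.fst • 1 := by
  ext i j
  change (Unitization.inl ((x.fst • (1 : Matrix ι ι ℂ)) i j) +
    Unitization.inr (x.snd i j) : Unitization ℂ B).fst = _
  simp

theorem continuous_plusToMat {ι X : Type*} [Fintype ι] [DecidableEq ι] [TopologicalSpace X]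
    (c : ℂ) {f : X → Matrix ι ι B} (hf : Continuous f) :
    Continuous fun t => plusToMat ι B (Unitization.inl c + Unitization.inr (f t)) := by
  refine continuous_matrix fun i j => ?_
  have h := (Unitization.continuous_inr (𝕜 := ℂ) (A := B)).comp (hf.matrix_elem i j)
  convert (continuous_const (y := (Unitization.inl ((c • (1 : Matrix ι ι ℂ)) i j) :
    Unitization ℂ B))).add h using 2 with t
  simp [plusToMat, scalarMat]

/-- The class in `K₁(B)` of a unitary `u ∈ M_n(B)⁺` that is congruent to `1` modulo `M_n(B)`. -/
noncomputable def K1.ofUnitary {n : ℕ} (u : Unitization ℂ (Matrix (Fin n) (Fin n) B))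
    (hu : u ∈ unitary (Unitization ℂ (Matrix (Fin n) (Fin n) B))) (h1 : u.fst = 1) : K1 B :=
  K1.mk (GLplus.mk (plusToMat (Fin n) B u) (plusToMat (Fin n) B (star u))
    (by rw [← map_mul, Unitary.mul_star_self_of_mem hu, map_one])
    (by rw [← map_mul, Unitary.star_mul_self_of_mem hu, map_one])
    (by rw [scalarPart_plusToMat, h1, one_smul]))

/-- `Q` is an inverse of `F` modulo the ideal `J`. -/
def IsParametrix {R : Type*} [Ring R] (J : TwoSidedIdeal R) (F Q : R) : Prop :=
  1 - Q * F ∈ J ∧ 1 - F * Q ∈ J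

/-- `F` is invertible modulo the ideal `J`. -/
def IsInvertibleMod {R : Type*} [Ring R] (J : TwoSidedIdeal R) (F : R) : Prop :=
  ∃ Q, IsParametrix J F Q

/-- The algebra `C([0,1], M_n(B))⁺`. -/
abbrev Cyl (n : ℕ) (B : Type*) [NonUnitalCStarAlgebra B] : Type _ :=
  Unitization ℂ C(I, Matrix (Fin n) (Fin n) B)

/-- Evaluation at `t`, as a map `C([0,1], M_n(B))⁺ → M_n(B)⁺`. -/
noncomputable def Cyl.eval {n : ℕ} (t : I) :
    Cyl n B →+* Unitization ℂ (Matrix (Fin n) (Fin n) B) where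
  toFun x := Unitization.inl x.fst + Unitization.inr (x.snd t)
  map_one' := by ext1 <;> simp
  map_mul' x y := by ext1 <;> simp
  map_zero' := by ext1 <;> simp
  map_add' x y := by ext1 <;> simp

/-- The ideal `C₀((0,1), M_n(B))` of `C([0,1], M_n(B))⁺`. -/
def suspIdeal (n : ℕ) (B : Type*) [NonUnitalCStarAlgebra B] : TwoSidedIdeal (Cyl n B) :=
  TwoSidedIdeal.mk' {x | x.fst = 0 ∧ x.snd 0 = 0 ∧ x.snd 1 = 0}
    (by simp)
    (by rintro x y ⟨h1, h2, h3⟩ ⟨h1', h2', h3'⟩; simp [h1, h2, h3, h1', h2', h3'])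
    (by rintro x ⟨h1, h2, h3⟩; simp [h1, h2, h3])
    (by rintro x y ⟨h1, h2, h3⟩; simp [h1, h2, h3])
    (by rintro x y ⟨h1, h2, h3⟩; simp [h1, h2, h3])

theorem mem_suspIdeal {n : ℕ} {x : Cyl n B} :
    x ∈ suspIdeal n B ↔ x.fst = 0 ∧ x.snd 0 = 0 ∧ x.snd 1 = 0 :=
  TwoSidedIdeal.mem_mk' ..

/-- The `2 × 2` matrix
`(S₀²  S₀ q; S₁ (1 + S₁) f  1 - S₁²)`, where `S₀ = 1 - q f` and `S₁ = 1 - f q`. -/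
def indexIdem {R : Type*} [Ring R] {ι : Type*} [Fintype ι] [DecidableEq ι] (f q : Matrix ι ι R) :
    Matrix (ι ⊕ ι) (ι ⊕ ι) R :=
  fromBlocks ((1 - q * f) * (1 - q * f)) ((1 - q * f) * q)
    ((1 - f * q) * (1 + (1 - f * q)) * f) (1 - (1 - f * q) * (1 - f * q))

theorem indexIdem_idem {R : Type*} [Ring R] {ι : Type*} [Fintype ι] [DecidableEq ι]
    (f q : Matrix ι ι R) : indexIdem f q * indexIdem f q = indexIdem f q := by
  rw [indexIdem, fromBlocks_multiply]
  congr 1 <;> noncomm_ring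

/-- The scalar projection `e₀ = diag(0, 1)`. -/
def lowerProj (ι : Type*) [Fintype ι] [DecidableEq ι] : Matrix (ι ⊕ ι) (ι ⊕ ι) ℂ :=
  fromBlocks 0 0 0 1

/-- The family of idempotents `e` associated with `F` and a parametrix `Q`. -/
noncomputable def relIdem {n : ℕ} (F Q : Cyl n B) :
    C(I, Matrix (Fin n ⊕ Fin n) (Fin n ⊕ Fin n) (Unitization ℂ B)) where
  toFun t := indexIdem (plusToMat (Fin n) B (Cyl.eval t F)) (plusToMat (Fin n) B (Cyl.eval t Q))
  continuous_toFun := by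
    have h : ∀ G : Cyl n B, Continuous fun t => plusToMat (Fin n) B (Cyl.eval t G) := fun G =>
      continuous_plusToMat _ G.snd.continuous
    have hF := h F
    have hQ := h Q
    unfold indexIdem
    fun_prop

theorem IsParametrix.isLoop {n : ℕ} {F Q : Cyl n B} (h : IsParametrix (suspIdeal n B) F Q) :
    IsLoop (lowerProj (Fin n)) (relIdem F Q) := by
  obtain ⟨h0, h1⟩ := h
  rw [mem_suspIdeal] at h0 h1
  have hscal : ∀ t, scalarPart (Fin n) B (plusToMat (Fin n) B (Cyl.eval t (1 - Q * F))) = 0 ∧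
      scalarPart (Fin n) B (plusToMat (Fin n) B (Cyl.eval t (1 - F * Q))) = 0 := fun t => by
    rw [scalarPart_plusToMat, scalarPart_plusToMat]
    simp only [Cyl.eval, RingHom.coe_mk, MonoidHom.coe_mk, OneHom.coe_mk, h0.1, h1.1]
    simp
  have hend : ∀ x : Cyl n B, ∀ t, x.fst = 0 → x.snd t = 0 → Cyl.eval t x = 0 :=
    fun x t hx hx' => by
      simp [Cyl.eval, hx, hx']
  have hp : scalarMat B (lowerProj (Fin n)) = fromBlocks 0 0 0 1 := by
    rw [lowerProj, scalarMat_block, scalarMat_one]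
    congr 1
  have hval : ∀ t, Cyl.eval t (1 - Q * F) = 0 → Cyl.eval t (1 - F * Q) = 0 →
      relIdem F Q t = scalarMat B (lowerProj (Fin n)) := fun t e0 e1 => by
    have e0' := congrArg (plusToMat (Fin n) B) e0
    have e1' := congrArg (plusToMat (Fin n) B) e1
    simp only [map_sub, map_mul, map_one, map_zero] at e0' e1'
    change indexIdem _ _ = _
    rw [indexIdem, e0', e1', hp]
    simp
  refine ⟨fun t => ?_, hval 0 (hend _ _ h0.1 h0.2.1) (hend _ _ h1.1 h1.2.1),
    hval 1 (hend _ _ h0.1 h0.2.2) (hend _ _ h1.1 h1.2.2)⟩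
  obtain ⟨e0, e1⟩ := hscal t
  simp only [map_sub, map_mul, map_one] at e0 e1
  have key : scalarPart (Fin n ⊕ Fin n) B (relIdem F Q t) =
      indexIdem (scalarPart _ _ (plusToMat (Fin n) B (Cyl.eval t F)))
        (scalarPart _ _ (plusToMat (Fin n) B (Cyl.eval t Q))) := by
    have hb : ∀ M : Matrix (Fin n) (Fin n) (Unitization ℂ B),
        M.map (Unitization.fstHom ℂ B) = scalarPart _ _ M := fun _ => rfl
    change scalarPart _ _ (indexIdem _ _) = _
    rw [indexIdem, scalarPart_fromBlocks, hb, hb, indexIdem]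
    simp only [map_sub, map_add, map_mul, map_one]
  rw [key, indexIdem, e0, e1, lowerProj]
  simp

/-- The class in `K₀(C₀((0,1), B))` defined by an element `F ∈ C([0,1], M_n(B))⁺` that is
invertible modulo `C₀((0,1), M_n(B))`, with parametrix `Q`: the formal difference `[e] - [e₀]`
of the idempotents
`e = (S₀²  S₀ Q; S₁ (1 + S₁) F  1 - S₁²)` and `e₀ = (0 0; 0 1)`, where `S₀ = 1 - Q F` and
`S₁ = 1 - F Q`. -/
noncomputable def relClass {n : ℕ} {F Q : Cyl n B} (h : IsParametrix (suspIdeal n B) F Q) :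
    K0 (Susp B) :=
  loopClass h.isLoop fun _ => indexIdem_idem _ _

end Relative

end KTheory

/-!
The index idempotent of `F` with parametrix `Q` is a conjugate of a scalar projection. With
`S₀ = 1 - Q F` and `S₁ = 1 - F Q`, the matrix
`z = ((1 + S₁) F  -S₁; S₀  Q)` is invertible, with inverse `(Q  S₀; -S₁  (1 + S₁) F)`, and
`z diag(1, 0) z⁻¹` is the idempotent `e` of the relative class after interchanging the two
diagonal blocks (`indexIdem_eq_conj`).

If `Q` is a parametrix of `F(t) = 1 - t + t u`, then `F` and `Q` are mutually inverse at `t = 0`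
and at `t = 1`, where `S₀` and `S₁` vanish. So `t ↦ z t` is a path in `GL⁺` from
`diag(1, 1)` to `diag(u, u⁻¹)` (`isRotation_parametrixPath`), that is, one of the paths which
compute `θ([u])` as `[z p z⁻¹] - [p]`; the interchange of blocks identifies this class with
`[e] - [e₀]`.
-/

namespace KTheory

open Matrix Topology unitInterval

section Cylinder

variable {B : Type*} [NonUnitalCStarAlgebra B] {n : ℕ}

theorem mem_suspIdeal_iff_eval {x : Cyl n B} :
    x ∈ suspIdeal n B ↔ Cyl.eval 0 x = 0 ∧ Cyl.eval 1 x = 0 := by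
  rw [mem_suspIdeal]
  have h : ∀ t, Cyl.eval t x = 0 ↔ x.fst = 0 ∧ x.snd t = 0 := fun t => by
    simp [Cyl.eval, Unitization.ext_iff]
  rw [h, h]
  tauto

theorem isParametrix_iff_eval {F Q : Cyl n B} : IsParametrix (suspIdeal n B) F Q ↔
    (Cyl.eval 0 Q * Cyl.eval 0 F = 1 ∧ Cyl.eval 1 Q * Cyl.eval 1 F = 1) ∧
      (Cyl.eval 0 F * Cyl.eval 0 Q = 1 ∧ Cyl.eval 1 F * Cyl.eval 1 Q = 1) := by
  simp only [IsParametrix, mem_suspIdeal_iff_eval, map_sub, map_one, map_mul, sub_eq_zero,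
    eq_comm (a := (1 : Unitization ℂ (Matrix (Fin n) (Fin n) B)))]

theorem Cyl.fst_eval (t : I) (x : Cyl n B) : (Cyl.eval t x).fst = x.fst := by
  simp [Cyl.eval]

/-- The straight line `t ↦ 1 - t + t v` from `1` to `v`, where `v ≡ 1` modulo `M_n(B)`. -/
noncomputable def linePath (v : Unitization ℂ (Matrix (Fin n) (Fin n) B)) : Cyl n B :=
  Unitization.inl 1 + Unitization.inr ⟨fun t => (t : ℂ) • v.snd, by fun_prop⟩

theorem eval_linePath {v : Unitization ℂ (Matrix (Fin n) (Fin n) B)} (hv : v.fst = 1) (t : I) :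
    Cyl.eval t (linePath v) = (1 - (t : ℂ)) • 1 + (t : ℂ) • v := by
  ext1 <;> simp [Cyl.eval, linePath, hv]

end Cylinder

section Conjugation

variable {R : Type*} [Ring R] {ι : Type*} [Fintype ι] [DecidableEq ι]

/-- The matrix `((1 + S₁) f  -S₁; S₀  q)` with `S₀ = 1 - q f` and `S₁ = 1 - f q`. It is invertible
for all `f` and `q`, and equals `diag(f, q)` when they are mutually inverse. -/
def parametrixUnit (f q : Matrix ι ι R) : (Matrix (ι ⊕ ι) (ι ⊕ ι) R)ˣ where
  val := fromBlocks ((1 + (1 - f * q)) * f) (-(1 - f * q)) (1 - q * f) q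
  inv := fromBlocks q (1 - q * f) (-(1 - f * q)) ((1 + (1 - f * q)) * f)
  val_inv := by
    rw [fromBlocks_multiply, ← fromBlocks_one]
    congr 1 <;> noncomm_ring
  inv_val := by
    rw [fromBlocks_multiply, ← fromBlocks_one]
    congr 1 <;> noncomm_ring

theorem parametrixUnit_val {f q : Matrix ι ι R} (h : f * q = 1) (h' : q * f = 1) :
    (parametrixUnit f q).val = fromBlocks f 0 0 q := by
  simp [parametrixUnit, h, h']

theorem indexIdem_eq_conj (f q : Matrix ι ι R) :
    indexIdem f q = ((parametrixUnit f q).val * fromBlocks 1 0 0 0 *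
      (parametrixUnit f q)⁻¹.val).submatrix (Equiv.sumComm ι ι) (Equiv.sumComm ι ι) := by
  change _ = Matrix.submatrix (fromBlocks ((1 + (1 - f * q)) * f) (-(1 - f * q)) (1 - q * f) q *
    fromBlocks 1 0 0 0 * fromBlocks q (1 - q * f) (-(1 - f * q)) ((1 + (1 - f * q)) * f)) _ _
  rw [fromBlocks_multiply, fromBlocks_multiply, Equiv.sumComm_apply,
    fromBlocks_submatrix_sum_swap_sum_swap, indexIdem]
  congr 1 <;> noncomm_ring

theorem continuous_parametrixUnit {X : Type*} [TopologicalSpace X] [TopologicalSpace R]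
    [IsTopologicalRing R] {f q : X → Matrix ι ι R} (hf : Continuous f) (hq : Continuous q) :
    Continuous fun x => parametrixUnit (f x) (q x) := by
  rw [Units.continuous_iff]
  constructor
  · change Continuous fun x =>
      fromBlocks ((1 + (1 - f x * q x)) * f x) (-(1 - f x * q x)) (1 - q x * f x) (q x)
    fun_prop
  · change Continuous fun x =>
      fromBlocks (q x) (1 - q x * f x) (-(1 - f x * q x)) ((1 + (1 - f x * q x)) * f x)
    fun_prop

end Conjugation

section Path

variable {B : Type*} [NonUnitalCStarAlgebra B] {n : ℕ}

theorem parametrixUnit_mem_GLplus {f q : Matrix (Fin n) (Fin n) (Unitization ℂ B)}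
    (hf : scalarPart (Fin n) B f = 1) (hq : scalarPart (Fin n) B q = 1) :
    parametrixUnit f q ∈ GLplus (Fin n ⊕ Fin n) B := by
  have hmap : ∀ M : Matrix (Fin n) (Fin n) (Unitization ℂ B),
      M.map (Unitization.fstHom ℂ B) = scalarPart _ _ M := fun _ => rfl
  rw [mem_GLplus]
  refine (scalarPart_fromBlocks _ _ _ _).trans ?_
  simp [hmap, hf, hq]

/-- The path `t ↦ ((1 + S₁) F  -S₁; S₀  Q)` in `GL_{2n}⁺(B)`, for `F` and `Q` congruent to `1`
modulo `C([0,1], M_n(B))`. -/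
noncomputable def parametrixPath {F Q : Cyl n B} (hF : F.fst = 1) (hQ : Q.fst = 1) :
    C(I, GLplus (Fin n ⊕ Fin n) B) where
  toFun t := ⟨parametrixUnit (plusToMat (Fin n) B (Cyl.eval t F))
      (plusToMat (Fin n) B (Cyl.eval t Q)), parametrixUnit_mem_GLplus
        (by rw [scalarPart_plusToMat, Cyl.fst_eval, hF, one_smul])
        (by rw [scalarPart_plusToMat, Cyl.fst_eval, hQ, one_smul])⟩
  continuous_toFun := Continuous.subtype_mk (continuous_parametrixUnit
    (continuous_plusToMat _ F.snd.continuous) (continuous_plusToMat _ Q.snd.continuous)) _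

theorem parametrixPath_eq_block {F Q : Cyl n B} (hF : F.fst = 1) (hQ : Q.fst = 1) {t : I}
    {v : GLplus (Fin n) B} (h : plusToMat (Fin n) B (Cyl.eval t F) = glMat v)
    (hQF : Cyl.eval t Q * Cyl.eval t F = 1) (hFQ : Cyl.eval t F * Cyl.eval t Q = 1) :
    parametrixPath hF hQ t = GLplus.block v v⁻¹ := by
  have hQF' := congrArg (plusToMat (Fin n) B) hQF
  have hFQ' := congrArg (plusToMat (Fin n) B) hFQ
  rw [map_mul, map_one] at hQF' hFQ'
  have hq : plusToMat (Fin n) B (Cyl.eval t Q) = glMat v⁻¹ :=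
    left_inv_eq_right_inv hQF' (by rw [h, GLplus.mat_mul_inv])
  refine GLplus.ext ?_
  rw [GLplus.mat_block, ← h, ← hq]
  exact parametrixUnit_val hFQ' hQF'

/-- If `F` runs from `1` to `v`, then the path attached to any parametrix of `F` is one of the
paths from `1` to `diag(v, v⁻¹)` that compute `θ([v])`. -/
theorem isRotation_parametrixPath {F Q : Cyl n B} (hF : F.fst = 1) (hQ : Q.fst = 1)
    (h : IsParametrix (suspIdeal n B) F Q) {v : GLplus (Fin n) B} (h0 : Cyl.eval 0 F = 1)
    (h1 : plusToMat (Fin n) B (Cyl.eval 1 F) = glMat v) :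
    IsRotation v (parametrixPath hF hQ) := by
  obtain ⟨⟨a0, a1⟩, b0, b1⟩ := isParametrix_iff_eval.1 h
  refine ⟨?_, parametrixPath_eq_block hF hQ h1 a1 b1⟩
  rw [parametrixPath_eq_block hF hQ (v := 1) (by rw [h0, map_one, GLplus.mat_one]) a0 b0,
    inv_one, GLplus.block_one]

/-- The relative class of `F` is the class `[z p z⁻¹] - [p]` of the path attached to a parametrix,
the two differing by the interchange of the diagonal blocks. -/
theorem relClass_eq_rotClass {F Q : Cyl n B} (hF : F.fst = 1) (hQ : Q.fst = 1)
    (h : IsParametrix (suspIdeal n B) F Q)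
    (hz : Rotates (stdProj (Fin n)) (parametrixPath hF hQ)) : relClass h = rotClass hz := by
  refine loopClass_rename _ _ (Equiv.sumComm (Fin n) (Fin n)) _ _ ?_ fun t => ?_
  · rw [stdProj, Equiv.sumComm_symm, Equiv.sumComm_apply,
      fromBlocks_submatrix_sum_swap_sum_swap, lowerProj]
  · rw [rotLoop_apply, scalarMat_stdProj]
    exact indexIdem_eq_conj _ _

end Path

end KTheory

theorem mainTheorem10 {B : Type*} [NonUnitalCStarAlgebra B] [TopologicalSpace.SeparableSpace B]
    (n : ℕ) (u : Unitization ℂ (Matrix (Fin n) (Fin n) B))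
    (hu : u ∈ unitary (Unitization ℂ (Matrix (Fin n) (Fin n) B))) (hu1 : u.fst = 1) :
    (∃ F : KTheory.Cyl n B, ∀ t : unitInterval,
      KTheory.Cyl.eval t F = (1 - (t : ℂ)) • 1 + (t : ℂ) • u) ∧
    ∀ F : KTheory.Cyl n B,
      (∀ t : unitInterval, KTheory.Cyl.eval t F = (1 - (t : ℂ)) • 1 + (t : ℂ) • u) →
        KTheory.IsInvertibleMod (KTheory.suspIdeal n B) F ∧
        ∀ (Q : KTheory.Cyl n B) (hQ : KTheory.IsParametrix (KTheory.suspIdeal n B) F Q),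
          KTheory.relClass hQ = KTheory.theta B (KTheory.K1.ofUnitary u hu hu1) := by
  refine ⟨⟨KTheory.linePath u, KTheory.eval_linePath hu1⟩, fun F hF => ?_⟩
  have h0 : KTheory.Cyl.eval 0 F = 1 := by simp [hF]
  have h1 : KTheory.Cyl.eval 1 F = u := by simp [hF]
  have hF1 : F.fst = 1 := by rw [← KTheory.Cyl.fst_eval 0, h0, Unitization.fst_one]
  refine ⟨⟨KTheory.linePath (star u), ?_⟩, fun Q hQ => ?_⟩
  · have hs : (star u).fst = 1 := by rw [Unitization.fst_star, hu1, star_one]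
    rw [KTheory.isParametrix_iff_eval]
    simp [h0, h1, KTheory.eval_linePath hs, Unitary.star_mul_self_of_mem hu,
      Unitary.mul_star_self_of_mem hu]
  · have hQ1 : Q.fst = 1 := by
      have h := (KTheory.isParametrix_iff_eval.1 hQ).1.1
      rw [h0, mul_one] at h
      rw [← KTheory.Cyl.fst_eval 0, h, Unitization.fst_one]
    have hz := KTheory.isRotation_parametrixPath hF1 hQ1 hQ
      (v := KTheory.GLplus.mk (KTheory.plusToMat (Fin n) B u)
        (KTheory.plusToMat (Fin n) B (star u))
        (by rw [← map_mul, Unitary.mul_star_self_of_mem hu, map_one])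
        (by rw [← map_mul, Unitary.star_mul_self_of_mem hu, map_one])
        (by rw [KTheory.scalarPart_plusToMat, hu1, one_smul])) h0 (by rw [h1]; rfl)
    rw [KTheory.relClass_eq_rotClass hF1 hQ1 hQ hz.rotates]
    exact (KTheory.theta_mk hz).symm
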